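/- Let $\mathfrak h$ be a complex Hilbert space (scalar product antilinear in the first argument) with an anti-unitary involution $\Gamma$, let $P$ be a basis projection, i.e. an orthogonal projection with $P+\Gamma P\Gamma=1$, put $\mathfrak p=P\mathfrak h$, and let $\mathfrak q\subset\mathfrak h$ be a closed subspace with $\Gamma\mathfrak q\subset\mathfrak q$. Let $\mathcal F=\bigoplus_{n\ge 0}\bigwedge^n\mathfrak p$ be the antisymmetric Fock space with vacuum $\Omega$, where $\langle p_1\wedge\dots\wedge p_n,r_1\wedge\dots\wedge r_n\rangle=\det(\langle p_j,r_k\rangle)$; let $c(p)^*$ be the creation operators, $c(p)^*(p_1\wedge\dots\wedge p_n)=p\wedge p_1\wedge\dots\wedge p_n$, and $c(p)$ the annihilation operators, $c(p)(p_1\wedge\dots\wedge p_n)=\sum_r(-1)^{r-1}\langle p,p_r\rangle\,p_1\wedge\dots\widehat{p_r}\dots\wedge p_n$, $c(p)\Omega=0$; put $a(f)=c(P\Gamma f)^*+c(Pf)$ for $f\in\mathfrak h$ and $\mathcal M(\mathfrak q)=\{a(q)\mid q\in\mathfrak q\}''$. Let $Z$ be the parity operator, equal to $(-1)^n$ on $\bigwedge^n\mathfrak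 p$, and $\widetilde Z=\frac1{1+i}(1+iZ)$. Assume that $\mathfrak p$ and $\mathfrak q$ are in generic position: $\mathfrak p\cap\mathfrak q=\mathfrak p\cap\mathfrak q^\perp=\mathfrak p^\perp\cap\mathfrak q=\mathfrak p^\perp\cap\mathfrak q^\perp=\{0\}$. Then $\Omega$ is cyclic and separating for $\mathcal M(\mathfrak q)$, and the Tomita operator $S$ of $(\mathcal M(\mathfrak q),\Omega)$, the closure of $A\Omega\mapsto A^*\Omega$ $(A\in\mathcal M(\mathfrak q))$, has a unique polar decomposition $S=J\Delta^{1/2}$ with $\Delta=S^*S$ and $J$ anti-unitary (the modular conjugation). Let $\beta$ be the antilinear operator in $\mathfrak p$ with graph $\{(Pq,P\Gamma q)\mid q\in\mathfrak q\}$ and $\Delta_{\mathfrak p}=\beta^*\beta$; it has a unique positive self-adjoint square root $\Delta_{\mathfrak p}^{1/2}$, whose domain contains $P\mathfrak q$. The formula $$Vq:=i\bigl(\Delta_{\mathfrak p}^{1/2}P\Gamma q-\Gamma\Delta_{\mathfrak p}^{1/2}Pq\bigr),\qquad q\in\mathfrak q,$$ defines an antilinear isometry $V$ of $\mathfrak q$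 onto $\mathfrak q^\perp$, and $$J\,a(q)\,J=\widetilde Z\,a(Vq)\,\widetilde Z^*\qquad\text{for every } q\in\mathfrak q .$$ -/

import Mathlib

noncomputable section

namespace CAR

open scoped ComplexConjugate InnerProductSpace SetRel

/-! ### The antisymmetric Fock space: algebraic part -/

section Algebraic

variable {K : Type*} [NormedAddCommGroup K] [InnerProductSpace ℂ K]

/-- `p₁ ∧ ⋯ ∧ pₙ ↦ p ∧ p₁ ∧ ⋯ ∧ pₙ`. -/
def wedgeLeft (p : K) : ExteriorAlgebra ℂ K →ₗ[ℂ] ExteriorAlgebra ℂ K :=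
  LinearMap.mulLeft ℂ (ExteriorAlgebra.ι ℂ p)

/-- `p₁ ∧ ⋯ ∧ pₙ ↦ ∑ r, (-1)^(r-1) ⟪p, p_r⟫ p₁ ∧ ⋯ (p_r omitted) ⋯ ∧ pₙ`. -/
def contract (p : K) : ExteriorAlgebra ℂ K →ₗ[ℂ] ExteriorAlgebra ℂ K :=
  CliffordAlgebra.contractLeft (Q := (0 : QuadraticForm ℂ K)) (innerSL ℂ p).toLinearMap

theorem contract_one (p : K) : contract p 1 = 0 :=
  CliffordAlgebra.contractLeft_one (Q := (0 : QuadraticForm ℂ K)) _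

theorem contract_wedgeLeft (p r : K) (x : ExteriorAlgebra ℂ K) :
    contract p (wedgeLeft r x) = ⟪p, r⟫_ℂ • x - wedgeLeft r (contract p x) :=
  CliffordAlgebra.contractLeft_ι_mul _ _ _

theorem contract_contract (p : K) (x : ExteriorAlgebra ℂ K) :
    contract p (contract p x) = 0 :=
  CliffordAlgebra.contractLeft_contractLeft _ _

theorem contract_add (p r : K) : contract (p + r) = contract p + contract r := by
  simp [contract]

theorem contract_smul (c : ℂ) (p : K) : contract (c • p) = conj c • contract p := by
  ext x
  simp [contract]

theorem wedgeLeft_wedgeLeft (p r : K) (x : ExteriorAlgebra ℂ K) :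
    wedgeLeft p (wedgeLeft r x) = -wedgeLeft r (wedgeLeft p x) := by
  rw [eq_neg_iff_add_eq_zero]
  simp only [wedgeLeft, LinearMap.mulLeft_apply, ← mul_assoc, ← add_mul]
  rw [ExteriorAlgebra.ι_add_mul_swap, zero_mul]

theorem wedgeLeft_self (p : K) (x : ExteriorAlgebra ℂ K) :
    wedgeLeft p (wedgeLeft p x) = 0 := by
  simp only [wedgeLeft, LinearMap.mulLeft_apply, ← mul_assoc]
  rw [ExteriorAlgebra.ι_sq_zero, zero_mul]

theorem wedge_induction {C : ExteriorAlgebra ℂ K → Prop} (x : ExteriorAlgebra ℂ K)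
    (h1 : C 1) (hs : ∀ (c : ℂ) x, C x → C (c • x)) (ha : ∀ x y, C x → C y → C (x + y))
    (hw : ∀ p x, C x → C (wedgeLeft p x)) : C x := by
  induction x using CliffordAlgebra.left_induction with
  | algebraMap r => rw [Algebra.algebraMap_eq_smul_one]; exact hs _ _ h1
  | add x y hx hy => exact ha _ _ hx hy
  | ι_mul x m hx => exact hw _ _ hx

/-- The opposite of the endomorphism algebra of the exterior algebra, on which scalars act through
their complex conjugates. -/
def ConjEndOp (K : Type*) [NormedAddCommGroup K] [InnerProductSpace ℂ K] : Type _ :=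
  (Module.End ℂ (ExteriorAlgebra ℂ K))ᵐᵒᵖ

instance : Ring (ConjEndOp K) :=
  inferInstanceAs (Ring (Module.End ℂ (ExteriorAlgebra ℂ K))ᵐᵒᵖ)

instance : Algebra ℂ (ConjEndOp K) :=
  RingHom.toAlgebra' ((algebraMap ℂ (Module.End ℂ (ExteriorAlgebra ℂ K))ᵐᵒᵖ).comp (starRingEnd ℂ))
    (fun c x => Algebra.commutes (A := (Module.End ℂ (ExteriorAlgebra ℂ K))ᵐᵒᵖ) (conj c) x)

/-- `contract p`, as a linear function of `p` with values in the conjugate opposite algebra. -/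
def contractOp : K →ₗ[ℂ] ConjEndOp K where
  toFun p := MulOpposite.op (contract p)
  map_add' p r := by rw [contract_add]; rfl
  map_smul' c p := by
    rw [contract_smul, RingHom.id_apply, Algebra.smul_def]
    exact (Algebra.smul_def (A := (Module.End ℂ (ExteriorAlgebra ℂ K))ᵐᵒᵖ) (conj c)
      (MulOpposite.op (contract p)))

theorem contractOp_mul_self (p : K) : (contractOp p * contractOp p : ConjEndOp K) = 0 :=
  congrArg MulOpposite.op (LinearMap.ext (contract_contract p))

/-- An element of the conjugate opposite algebra, as an operator on the exterior algebra. -/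
def ConjEndOp.act (T : ConjEndOp K) : Module.End ℂ (ExteriorAlgebra ℂ K) :=
  MulOpposite.unop T

theorem ConjEndOp.act_one : (1 : ConjEndOp K).act = 1 := rfl

theorem ConjEndOp.act_add (S T : ConjEndOp K) : (S + T).act = S.act + T.act := rfl

theorem ConjEndOp.act_mul (S T : ConjEndOp K) : (S * T).act = T.act * S.act := rfl

theorem ConjEndOp.act_smul (c : ℂ) (T : ConjEndOp K) : (c • T).act = conj c • T.act := by
  rw [Algebra.smul_def, ConjEndOp.act_mul]
  refine LinearMap.ext fun x => ?_
  change T.act (conj c • x) = _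
  rw [map_smul]; rfl

theorem act_contractOp (p : K) : (contractOp p).act = contract p := rfl

/-- The antilinear map `p₁ ∧ ⋯ ∧ pₙ ↦ contract pₙ ∘ ⋯ ∘ contract p₁`. -/
def contractAll : ExteriorAlgebra ℂ K →ₐ[ℂ] ConjEndOp K :=
  ExteriorAlgebra.lift ℂ ⟨contractOp, contractOp_mul_self⟩

/-- The scalar product on the exterior algebra: the component in degree zero of
`contract pₙ (⋯ (contract p₁ y))`, for `x = p₁ ∧ ⋯ ∧ pₙ`, which makes
`⟪p₁ ∧ ⋯ ∧ pₙ, r₁ ∧ ⋯ ∧ rₘ⟫ = δₙₘ det ⟪p_j, r_k⟫`. -/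
def wedgeInner (x y : ExteriorAlgebra ℂ K) : ℂ :=
  ExteriorAlgebra.algebraMapInv ((contractAll x).act y)

theorem wedgeInner_one (y : ExteriorAlgebra ℂ K) :
    wedgeInner 1 y = ExteriorAlgebra.algebraMapInv y := by
  unfold wedgeInner
  rw [map_one, ConjEndOp.act_one]; rfl

theorem wedgeInner_add_left (x y z : ExteriorAlgebra ℂ K) :
    wedgeInner (x + y) z = wedgeInner x z + wedgeInner y z := by
  unfold wedgeInner
  rw [map_add, ConjEndOp.act_add, LinearMap.add_apply, map_add]

theorem wedgeInner_smul_left (c : ℂ) (x y : ExteriorAlgebra ℂ K) :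
    wedgeInner (c • x) y = conj c * wedgeInner x y := by
  unfold wedgeInner
  rw [map_smul, ConjEndOp.act_smul, LinearMap.smul_apply, map_smul, smul_eq_mul]

theorem wedgeInner_add_right (x y z : ExteriorAlgebra ℂ K) :
    wedgeInner x (y + z) = wedgeInner x y + wedgeInner x z := by
  simp [wedgeInner]

theorem wedgeInner_smul_right (c : ℂ) (x y : ExteriorAlgebra ℂ K) :
    wedgeInner x (c • y) = c * wedgeInner x y := by
  simp [wedgeInner]

theorem wedgeInner_sub_right (x y z : ExteriorAlgebra ℂ K) :
    wedgeInner x (y - z) = wedgeInner x y - wedgeInner x z := by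
  simp [wedgeInner]

theorem wedgeInner_zero_left (x : ExteriorAlgebra ℂ K) : wedgeInner 0 x = 0 := by
  simpa using wedgeInner_smul_left 0 0 x

theorem wedgeInner_sub_left (x y z : ExteriorAlgebra ℂ K) :
    wedgeInner (x - y) z = wedgeInner x z - wedgeInner y z := by
  have := wedgeInner_add_left (x - y) y z
  rw [sub_add_cancel] at this
  rw [this, add_sub_cancel_right]

theorem wedgeInner_wedge_left (p : K) (x y : ExteriorAlgebra ℂ K) :
    wedgeInner (wedgeLeft p x) y = wedgeInner x (contract p y) := by
  have h : contractAll (wedgeLeft p x) = (contractOp p * contractAll x : ConjEndOp K) := by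
    unfold contractAll wedgeLeft
    rw [LinearMap.mulLeft_apply, map_mul, ExteriorAlgebra.lift_ι_apply]
  unfold wedgeInner
  rw [h, ConjEndOp.act_mul, act_contractOp]; rfl

theorem wedgeInner_contract_left (p : K) (x y : ExteriorAlgebra ℂ K) :
    wedgeInner (contract p y) x = wedgeInner y (wedgeLeft p x) := by
  induction y using wedge_induction generalizing x p with
  | h1 =>
    rw [contract_one, wedgeInner_zero_left, wedgeInner_one]
    simp [wedgeLeft, ExteriorAlgebra.algebraMapInv]
  | hs c y hy => rw [map_smul, wedgeInner_smul_left, wedgeInner_smul_left, hy]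
  | ha y z hy hz => rw [map_add, wedgeInner_add_left, wedgeInner_add_left, hy, hz]
  | hw r y hy =>
    rw [contract_wedgeLeft, wedgeInner_sub_left, wedgeInner_smul_left, wedgeInner_wedge_left,
      wedgeInner_wedge_left, contract_wedgeLeft, wedgeInner_sub_right, wedgeInner_smul_right, hy,
      inner_conj_symm]

theorem wedgeInner_wedge_add_contract (p : K) (x : ExteriorAlgebra ℂ K) :
    wedgeInner (wedgeLeft p x) (wedgeLeft p x) + wedgeInner (contract p x) (contract p x)
      = ⟪p, p⟫_ℂ * wedgeInner x x := by
  rw [wedgeInner_wedge_left, contract_wedgeLeft, wedgeInner_contract_left, wedgeInner_sub_right,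
    wedgeInner_smul_right, sub_add_cancel]

theorem wedgeInner_conj_symm (x y : ExteriorAlgebra ℂ K) :
    conj (wedgeInner y x) = wedgeInner x y := by
  induction x using wedge_induction generalizing y with
  | h1 =>
    induction y using wedge_induction with
    | h1 => simp [wedgeInner_one]
    | hs c y hy => rw [wedgeInner_smul_left, wedgeInner_smul_right, map_mul, hy]; simp
    | ha y z hy hz => rw [wedgeInner_add_left, wedgeInner_add_right, map_add, hy, hz]
    | hw p y hy =>
      rw [wedgeInner_wedge_left, contract_one, ← wedgeInner_contract_left, contract_one,
        wedgeInner_zero_left]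
      simp [wedgeInner]
  | hs c x hx => rw [wedgeInner_smul_left, wedgeInner_smul_right, map_mul, hx]
  | ha x z hx hz => rw [wedgeInner_add_left, wedgeInner_add_right, map_add, hx, hz]
  | hw p x hx => rw [wedgeInner_wedge_left, ← wedgeInner_contract_left, hx]

/-- The span of the wedge products of vectors of a list, taken in its order. -/
def wedgeSpan : List K → Submodule ℂ (ExteriorAlgebra ℂ K)
  | [] => Submodule.span ℂ {1}
  | e :: l => wedgeSpan l ⊔ (wedgeSpan l).map (wedgeLeft e)

theorem mem_wedgeSpan_cons {e : K} {l : List K} {x : ExteriorAlgebra ℂ K} :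
    x ∈ wedgeSpan (e :: l) ↔
      ∃ y ∈ wedgeSpan l, ∃ z ∈ wedgeSpan l, y + wedgeLeft e z = x := by
  simp [wedgeSpan, Submodule.mem_sup]

theorem one_mem_wedgeSpan (l : List K) : (1 : ExteriorAlgebra ℂ K) ∈ wedgeSpan l := by
  induction l with
  | nil => exact Submodule.mem_span_singleton_self _
  | cons e l ih => exact Submodule.mem_sup_left ih

theorem wedgeLeft_mem_wedgeSpan {l : List K} {e : K} (he : e ∈ l) {x : ExteriorAlgebra ℂ K}
    (hx : x ∈ wedgeSpan l) : wedgeLeft e x ∈ wedgeSpan l := by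
  induction l generalizing x with
  | nil => simp at he
  | cons a l ih =>
    obtain ⟨y, hy, z, hz, rfl⟩ := mem_wedgeSpan_cons.1 hx
    rw [mem_wedgeSpan_cons]
    rcases List.mem_cons.1 he with rfl | he
    · exact ⟨0, zero_mem _, y, hy, by rw [map_add, wedgeLeft_self, zero_add, add_zero]⟩
    · exact ⟨_, ih he hy, -wedgeLeft e z, neg_mem (ih he hz), by
        rw [map_add, wedgeLeft_wedgeLeft e a, map_neg]⟩

theorem contract_eq_zero_of_mem_wedgeSpan {l : List K} {e : K} (he : ∀ r ∈ l, ⟪e, r⟫_ℂ = 0)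
    {x : ExteriorAlgebra ℂ K} (hx : x ∈ wedgeSpan l) : contract e x = 0 := by
  induction l generalizing x with
  | nil =>
    obtain ⟨c, rfl⟩ := Submodule.mem_span_singleton.1 hx
    rw [map_smul, contract_one, smul_zero]
  | cons a l ih =>
    obtain ⟨y, hy, z, hz, rfl⟩ := mem_wedgeSpan_cons.1 hx
    have ih' := fun {x} => ih (x := x) (fun r hr => he r (List.mem_cons_of_mem _ hr))
    rw [map_add, contract_wedgeLeft, ih' hy, ih' hz, he a List.mem_cons_self]
    simp

theorem wedgeInner_self_nonneg_of_mem_wedgeSpan {l : List K}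
    (ho : l.Pairwise fun e r => ⟪e, r⟫_ℂ = 0) (hn : ∀ e ∈ l, ⟪e, e⟫_ℂ = 1)
    {x : ExteriorAlgebra ℂ K} (hx : x ∈ wedgeSpan l) : 0 ≤ (wedgeInner x x).re := by
  induction l generalizing x with
  | nil =>
    obtain ⟨c, rfl⟩ := Submodule.mem_span_singleton.1 hx
    rw [wedgeInner_smul_left, wedgeInner_smul_right, wedgeInner_one, map_one, mul_one,
      ← Complex.normSq_eq_conj_mul_self, Complex.ofReal_re]
    exact Complex.normSq_nonneg c
  | cons a l ih =>
    obtain ⟨y, hy, z, hz, rfl⟩ := mem_wedgeSpan_cons.1 hx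
    rw [List.pairwise_cons] at ho
    have ih' := fun {x} => ih (x := x) ho.2 (fun r hr => hn r (List.mem_cons_of_mem _ hr))
    have hcy := contract_eq_zero_of_mem_wedgeSpan ho.1 hy
    have hcz := contract_eq_zero_of_mem_wedgeSpan ho.1 hz
    have h0 : wedgeInner z 0 = 0 := by simpa using wedgeInner_smul_right 0 z 0
    have : wedgeInner (y + wedgeLeft a z) (y + wedgeLeft a z)
        = wedgeInner y y + wedgeInner z z := by
      rw [wedgeInner_add_left, wedgeInner_add_right, wedgeInner_wedge_left,
        ← wedgeInner_contract_left, hcy, wedgeInner_zero_left, map_add, hcy, contract_wedgeLeft,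
        hcz, hn a List.mem_cons_self]
      simp
    rw [this, Complex.add_re]
    exact add_nonneg (ih' hy) (ih' hz)

theorem exists_finiteDimensional (x : ExteriorAlgebra ℂ K) :
    ∃ V : Submodule ℂ K, FiniteDimensional ℂ V ∧
      ∀ W : Submodule ℂ (ExteriorAlgebra ℂ K), 1 ∈ W →
        (∀ v ∈ V, ∀ y ∈ W, wedgeLeft v y ∈ W) → x ∈ W := by
  induction x using wedge_induction with
  | h1 => exact ⟨⊥, inferInstance, fun W h _ => h⟩
  | hs c x hx =>
    obtain ⟨V, hV, h⟩ := hx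
    exact ⟨V, hV, fun W h1 hW => W.smul_mem c (h W h1 hW)⟩
  | ha x y hx hy =>
    obtain ⟨V, hV, h⟩ := hx
    obtain ⟨V', hV', h'⟩ := hy
    exact ⟨V ⊔ V', inferInstance, fun W h1 hW => W.add_mem
      (h W h1 fun v hv => hW v (Submodule.mem_sup_left hv))
      (h' W h1 fun v hv => hW v (Submodule.mem_sup_right hv))⟩
  | hw p x hx =>
    obtain ⟨V, hV, h⟩ := hx
    exact ⟨V ⊔ Submodule.span ℂ {p}, inferInstance, fun W h1 hW =>
      hW p (Submodule.mem_sup_right (Submodule.mem_span_singleton_self p)) _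
        (h W h1 fun v hv => hW v (Submodule.mem_sup_left hv))⟩

theorem wedgeInner_self_nonneg (x : ExteriorAlgebra ℂ K) : 0 ≤ (wedgeInner x x).re := by
  obtain ⟨V, hV, h⟩ := exists_finiteDimensional x
  let b := stdOrthonormalBasis ℂ V
  let l : List K := List.ofFn fun i => (b i : K)
  have hb := orthonormal_iff_ite.1 b.orthonormal
  have hb' : ∀ i j, ⟪(b i : K), (b j : K)⟫_ℂ = if i = j then 1 else 0 := hb
  refine wedgeInner_self_nonneg_of_mem_wedgeSpan (l := l) ?_ ?_ (h _ (one_mem_wedgeSpan l) ?_)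
  · refine List.pairwise_ofFn.2 fun i j hij => ?_
    rw [hb', if_neg hij.ne]
  · intro e he
    obtain ⟨i, rfl⟩ := (List.mem_ofFn' _ _).1 he
    rw [hb', if_pos rfl]
  · intro v hv y hy
    have hsum : v = ∑ i, b.repr ⟨v, hv⟩ i • (b i : K) := by
      have := congrArg (Subtype.val) (b.sum_repr ⟨v, hv⟩)
      simpa using this.symm
    have hlin : wedgeLeft v y = ∑ i, b.repr ⟨v, hv⟩ i • wedgeLeft (b i : K) y := by
      conv_lhs => rw [hsum]
      simp [wedgeLeft, Finset.sum_mul]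
    rw [hlin]
    refine Submodule.sum_mem _ fun i _ => Submodule.smul_mem _ _ ?_
    exact wedgeLeft_mem_wedgeSpan ((List.mem_ofFn' _ _).2 ⟨i, rfl⟩) hy

theorem involute_wedgeLeft (r : K) (y : ExteriorAlgebra ℂ K) :
    CliffordAlgebra.involute (wedgeLeft r y) = -wedgeLeft r (CliffordAlgebra.involute y) := by
  have h : CliffordAlgebra.involute (ExteriorAlgebra.ι ℂ r) = -ExteriorAlgebra.ι ℂ r :=
    CliffordAlgebra.involute_ι r
  simp only [wedgeLeft, LinearMap.mulLeft_apply, map_mul]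
  rw [h, neg_mul]

theorem contract_involute (p : K) (x : ExteriorAlgebra ℂ K) :
    contract p (CliffordAlgebra.involute x) = -CliffordAlgebra.involute (contract p x) := by
  induction x using wedge_induction with
  | h1 => simp [contract_one]
  | hs c x hx => simp [hx]
  | ha x y hx hy => rw [map_add, map_add, map_add, map_add, hx, hy, neg_add]
  | hw r x hx =>
    rw [involute_wedgeLeft, map_neg, contract_wedgeLeft, contract_wedgeLeft, hx, map_sub, map_smul,
      involute_wedgeLeft, map_neg]

theorem wedgeInner_involute (x y : ExteriorAlgebra ℂ K) :
    wedgeInner (CliffordAlgebra.involute x) (CliffordAlgebra.involute y) = wedgeInner x y := by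
  induction x using wedge_induction generalizing y with
  | h1 =>
    rw [map_one, wedgeInner_one, wedgeInner_one]
    induction y using wedge_induction with
    | h1 => simp
    | hs c y hy => rw [map_smul, map_smul, map_smul, hy]
    | ha y z hy hz => rw [map_add, map_add, map_add, hy, hz]
    | hw p y hy =>
      rw [involute_wedgeLeft]
      simp [wedgeLeft, ExteriorAlgebra.algebraMapInv]
  | hs c x hx => rw [map_smul, wedgeInner_smul_left, wedgeInner_smul_left, hx]
  | ha x z hx hz => rw [map_add, wedgeInner_add_left, wedgeInner_add_left, hx, hz]
  | hw p x hx =>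
    rw [involute_wedgeLeft, ← neg_one_smul ℂ (wedgeLeft p _), wedgeInner_smul_left,
      wedgeInner_wedge_left, wedgeInner_wedge_left, contract_involute,
      ← neg_one_smul ℂ (CliffordAlgebra.involute (contract p y)), wedgeInner_smul_right, hx]
    simp

end Algebraic

/-! ### The antisymmetric Fock space: completion -/

/-- The algebraic direct sum of the exterior powers of `K`, with the scalar product in which
`⟪p₁ ∧ ⋯ ∧ pₙ, r₁ ∧ ⋯ ∧ rₘ⟫ = δₙₘ det ⟪p_j, r_k⟫`. -/
def PreFock (K : Type*) [NormedAddCommGroup K] [InnerProductSpace ℂ K] : Type _ :=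
  ExteriorAlgebra ℂ K

section Fock

variable (K : Type*) [NormedAddCommGroup K] [InnerProductSpace ℂ K]

instance PreFock.instAddCommGroup : AddCommGroup (PreFock K) :=
  inferInstanceAs (AddCommGroup (ExteriorAlgebra ℂ K))

instance PreFock.instModule : Module ℂ (PreFock K) :=
  inferInstanceAs (Module ℂ (ExteriorAlgebra ℂ K))

instance PreFock.instCore : PreInnerProductSpace.Core ℂ (PreFock K) where
  inner x y := wedgeInner (K := K) x y
  conj_inner_symm := wedgeInner_conj_symm
  re_inner_nonneg := wedgeInner_self_nonneg
  add_left := wedgeInner_add_left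
  smul_left x y c := wedgeInner_smul_left c x y

instance PreFock.instSeminormedAddCommGroup : SeminormedAddCommGroup (PreFock K) :=
  InnerProductSpace.Core.toSeminormedAddCommGroup (𝕜 := ℂ)

instance PreFock.instInnerProductSpace : InnerProductSpace ℂ (PreFock K) :=
  InnerProductSpace.ofCore (PreFock.instCore K)

/-- The antisymmetric Fock space over `K`, the Hilbert space direct sum of the exterior powers. -/
abbrev Fock : Type _ := UniformSpace.Completion (PreFock K)

variable {K}

/-- `wedgeLeft p`, on the space with scalar product. -/
def PreFock.wedge (p : K) : PreFock K →ₗ[ℂ] PreFock K := wedgeLeft p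

/-- `contract p`, on the space with scalar product. -/
def PreFock.contr (p : K) : PreFock K →ₗ[ℂ] PreFock K := contract p

/-- `p₁ ∧ ⋯ ∧ pₙ ↦ (-1)^n p₁ ∧ ⋯ ∧ pₙ`, on the space with scalar product. -/
def PreFock.par : PreFock K →ₗ[ℂ] PreFock K :=
  (CliffordAlgebra.involute (Q := (0 : QuadraticForm ℂ K))).toLinearMap

variable (K) in
/-- The unit `1` of the exterior algebra, on the space with scalar product. -/
def PreFock.unit : PreFock K := (1 : ExteriorAlgebra ℂ K)

theorem PreFock.inner_def (x y : PreFock K) : ⟪x, y⟫_ℂ = wedgeInner (K := K) x y := rfl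

theorem PreFock.norm_sq_add_norm_sq (p : K) (x : PreFock K) :
    ‖PreFock.wedge p x‖ ^ 2 + ‖PreFock.contr p x‖ ^ 2 = ‖p‖ ^ 2 * ‖x‖ ^ 2 := by
  have h1 : ⟪PreFock.wedge p x, PreFock.wedge p x⟫_ℂ + ⟪PreFock.contr p x, PreFock.contr p x⟫_ℂ
      = ⟪p, p⟫_ℂ * ⟪x, x⟫_ℂ := wedgeInner_wedge_add_contract p x
  simp only [inner_self_eq_norm_sq_to_K] at h1
  exact_mod_cast h1

theorem PreFock.norm_wedge_le (p : K) (x : PreFock K) : ‖PreFock.wedge p x‖ ≤ ‖p‖ * ‖x‖ := by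
  have h := PreFock.norm_sq_add_norm_sq p x
  refine abs_le_of_sq_le_sq' ?_ (by positivity) |>.2
  nlinarith [sq_nonneg ‖PreFock.contr p x‖]

theorem PreFock.norm_contr_le (p : K) (x : PreFock K) : ‖PreFock.contr p x‖ ≤ ‖p‖ * ‖x‖ := by
  have h := PreFock.norm_sq_add_norm_sq p x
  refine abs_le_of_sq_le_sq' ?_ (by positivity) |>.2
  nlinarith [sq_nonneg ‖PreFock.wedge p x‖]

theorem PreFock.norm_par_le (x : PreFock K) : ‖PreFock.par x‖ ≤ 1 * ‖x‖ := by
  rw [one_mul, norm_eq_sqrt_re_inner (𝕜 := ℂ), norm_eq_sqrt_re_inner (𝕜 := ℂ) x,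
    PreFock.inner_def, PreFock.inner_def]
  exact le_of_eq (congrArg _ (congrArg _ (wedgeInner_involute x x)))

/-- The creation operator `c(p)*`, where `c(p)* Ω = p` and
`c(p)* (p₁ ∧ ⋯ ∧ pₙ) = p ∧ p₁ ∧ ⋯ ∧ pₙ`. -/
def creation (p : K) : Fock K →L[ℂ] Fock K :=
  ContinuousLinearMap.completion
    ((PreFock.wedge p).mkContinuous ‖p‖ (PreFock.norm_wedge_le p))

/-- The annihilation operator `c(p)`, where `c(p) Ω = 0` and
`c(p) (p₁ ∧ ⋯ ∧ pₙ) = ∑ r, (-1)^(r-1) ⟪p, p_r⟫ p₁ ∧ ⋯ (p_r omitted) ⋯ ∧ pₙ`. -/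
def annihilation (p : K) : Fock K →L[ℂ] Fock K :=
  ContinuousLinearMap.completion
    ((PreFock.contr p).mkContinuous ‖p‖ (PreFock.norm_contr_le p))

/-- The parity operator `Z (p₁ ∧ ⋯ ∧ pₙ) = (-1)^n p₁ ∧ ⋯ ∧ pₙ`. -/
def parity : Fock K →L[ℂ] Fock K :=
  ContinuousLinearMap.completion
    (PreFock.par.mkContinuous 1 PreFock.norm_par_le)

/-- The twist operator `Z̃ = (1 + i)⁻¹ (1 + i Z)`. -/
def twist : Fock K →L[ℂ] Fock K :=
  (1 + Complex.I)⁻¹ • (1 + Complex.I • parity)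

variable (K)

/-- The Fock vacuum `Ω`. -/
def vacuum : Fock K := UniformSpace.Completion.coe' (PreFock.unit K)

end Fock

/-! ### Unbounded operators, given by their graphs, and modular theory -/

section Modular

variable {E : Type*} [NormedAddCommGroup E] [InnerProductSpace ℂ E]

/-- The graph of the adjoint of the antilinear operator with graph `G`:
`(y, z)` belongs to it iff `⟪y, G x⟫ = ⟪x, z⟫` for all `x` in the domain of `G`. -/
def antilinearAdjoint (G : SetRel E E) : SetRel E E :=
  {w | ∀ v ∈ G, ⟪w.1, v.2⟫_ℂ = ⟪v.1, w.2⟫_ℂ}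

variable [CompleteSpace E]

/-- `T` is a positive self-adjoint square root of the operator with graph `G`, that is
`T = T*`, `T ≥ 0` and `T ∘ T = G` (with equality of the domains). -/
structure IsPositiveSqrt (T : E →ₗ.[ℂ] E) (G : SetRel E E) : Prop where
  isSelfAdjoint : IsSelfAdjoint T
  nonneg : ∀ x : T.domain, 0 ≤ (⟪(x : E), T x⟫_ℂ).re
  sq_eq : (T.graph : SetRel E E) ○ (T.graph : SetRel E E) = G

/-- The graph of the Tomita operator `S` of `(M, Ω)`, the closure of `A Ω ↦ A* Ω`, `A ∈ M`. -/
def tomita (M : Set (E →L[ℂ] E)) (Ω : E) : SetRel E E :=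
  closure {z | ∃ A ∈ M, z = (A Ω, star A Ω)}

/-- `J` is the modular conjugation of `(M, Ω)`, the antiunitary factor in the polar decomposition
`S = J Δ^{1/2}` of the Tomita operator, where `Δ = S* S`. -/
def IsModularConjugation (M : Set (E →L[ℂ] E)) (Ω : E) (J : E ≃ₛₗᵢ[starRingEnd ℂ] E) : Prop :=
  ∃ D : E →ₗ.[ℂ] E,
    IsPositiveSqrt D (tomita M Ω ○ antilinearAdjoint (tomita M Ω)) ∧
    tomita M Ω = {z | ∃ x : D.domain, z = ((x : E), J (D x))}

/-- `M Ω` is dense. -/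
def IsCyclic (M : Set (E →L[ℂ] E)) (Ω : E) : Prop :=
  Dense ((fun A : E →L[ℂ] E => A Ω) '' M)

/-- `A Ω = 0` with `A ∈ M` only for `A = 0`. -/
def IsSeparating (M : Set (E →L[ℂ] E)) (Ω : E) : Prop :=
  ∀ A ∈ M, A Ω = 0 → A = 0

end Modular

/-! ### The self-dual CAR algebra in the Fock representation -/

section SelfDual

variable {H : Type*} [NormedAddCommGroup H] [InnerProductSpace ℂ H] [CompleteSpace H]

/-- A basis projection for `Γ`: an orthogonal projection `P` with `P + Γ P Γ = 1`. -/
structure BasisProjection (Γ : H ≃ₛₗᵢ[starRingEnd ℂ] H) where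
  toCLM : H →L[ℂ] H
  isStarProjection : IsStarProjection toCLM
  add_conj : ∀ f, toCLM f + Γ (toCLM (Γ f)) = f

variable {Γ : H ≃ₛₗᵢ[starRingEnd ℂ] H}

/-- The one-particle space `𝔭 = P H`. -/
def BasisProjection.range (P : BasisProjection Γ) : Submodule ℂ H :=
  LinearMap.range (P.toCLM : H →ₗ[ℂ] H)

instance (P : BasisProjection Γ) : CompleteSpace P.range :=
  (ContinuousLinearMap.IsIdempotentElem.isClosed_range
    P.isStarProjection.isIdempotentElem).completeSpace_coe

/-- `P f`, as an element of the one-particle space. -/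
def BasisProjection.proj (P : BasisProjection Γ) (f : H) : P.range :=
  ⟨P.toCLM f, f, rfl⟩

/-- The generator `a(f) = c(P Γ f)* + c(P f)` in the Fock representation. -/
def field (P : BasisProjection Γ) (f : H) : Fock P.range →L[ℂ] Fock P.range :=
  creation (P.proj (Γ f)) + annihilation (P.proj f)

/-- The von Neumann algebra `M(𝔮) = {a(q) | q ∈ 𝔮}''`. -/
def localAlgebra (P : BasisProjection Γ) (𝔮 : Submodule ℂ H) :
    Set (Fock P.range →L[ℂ] Fock P.range) :=
  Set.centralizer (Set.centralizer (field P '' (𝔮 : Set H)))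

/-- Two closed subspaces are in generic position. -/
structure GenericPosition (𝔭 𝔮 : Submodule ℂ H) : Prop where
  inf_eq_bot : 𝔭 ⊓ 𝔮 = ⊥
  inf_orthogonal_eq_bot : 𝔭 ⊓ 𝔮ᗮ = ⊥
  orthogonal_inf_eq_bot : 𝔭ᗮ ⊓ 𝔮 = ⊥
  orthogonal_inf_orthogonal_eq_bot : 𝔭ᗮ ⊓ 𝔮ᗮ = ⊥

/-- The graph `{(P q, P Γ q) | q ∈ 𝔮}` of the antilinear operator `β` in `𝔭`. -/
def betaGraph (P : BasisProjection Γ) (𝔮 : Submodule ℂ H) : SetRel P.range P.range :=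
  {z | ∃ q ∈ 𝔮, z = (P.proj q, P.proj (Γ q))}

/-- The graph of `Δ_𝔭 = β* β`. -/
def oneParticleModular (P : BasisProjection Γ) (𝔮 : Submodule ℂ H) : SetRel P.range P.range :=
  betaGraph P 𝔮 ○ antilinearAdjoint (betaGraph P 𝔮)

end SelfDual

end CAR

end

noncomputable section

namespace CAR

open scoped ComplexConjugate InnerProductSpace SetRel

/-! ### Positive square roots and polar decompositions of unbounded operators -/

section Unbounded

variable {E : Type*} [NormedAddCommGroup E] [InnerProductSpace ℂ E]

/-! The position of `𝔮` relative to `𝔭` is encoded in bounded operators on `𝔭`. Let `Q` be the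
orthogonal projection onto `𝔮`, and put `B = PQ` and `X = PΓQ`, both restricted to `𝔭`. From `ΓPΓ =
1 - P` and `ΓQ = QΓ` one gets `X² = B - B²` and `XB = (1 - B)X`. Generic position makes `B` and `1 -
B` injective. With `b = B^{1/2}` and `c = (1 - B)^{1/2}`, the polar decomposition `X = j b c` gives
an antiunitary involution `j` with `j b = c j`, and `u ↦ b u + Γ b j u` is a unitary of `𝔭` onto `𝔮`
(`exists_modularPair`, `exists_isModularPairOf`). Hence `β = j c b⁻¹`, `Δ_𝔭^{1/2} = c b⁻¹`, and the
generators of the algebra are `c(b j u)* + c(b u)`.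

On the Fock space write `F(b)`, `F(c)` for the second quantizations, and let `J` be the antiunitary
`p₁ ∧ ⋯ ∧ pₙ ↦ j pₙ ∧ ⋯ ∧ j p₁`; the order is reversed because adjoints reverse products. Pulled
through `F(b)`, the generators become algebraic operators `lowered u` on the exterior algebra. Their
products applied to `1` span it, so for each `y` some `x` in the algebra has `x Ω = F(b) y`, which
gives cyclicity. Because `J`-conjugates of lowered operators commute with lowered operators
(`lowered_comm`), also `x* Ω = F(b) J y = J F(c) y` (`exists_isLift`). So `S` extends `J F(c)
F(b)⁻¹`. The elements `J x J` lie in the commutant, which gives the separating property and the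
opposite inclusion (`isSeparating`, `tomita_eq`). The quotient `F(c) F(b)⁻¹` is positive
self-adjoint, so this is the polar decomposition, and uniqueness of positive square roots
(`IsPositiveSqrt.unique`) identifies the modular conjugation with `J`.

Finally, `J` conjugates a generator into creation and annihilation operators multiplied by the
parity, which is what the twist makes of `a(i (c j u - Γ c u))` (`fj_field_fj`). As `Δ_𝔭^{1/2} b u =
c u`, the argument of `a` is `V q` for `q = b u + Γ b j u`. -/

theorem inner_map_map_of_antiunitary (J : E →ₛₗᵢ[starRingEnd ℂ] E) (x y : E) :
    ⟪J x, J y⟫_ℂ = ⟪y, x⟫_ℂ := by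
  -- Polarization over the reals preserves only real parts; antilinearity applied to `i x` then
  -- turns this into a sign change of the imaginary part.
  have hre (x y : E) : (⟪J x, J y⟫_ℂ).re = (⟪x, y⟫_ℂ).re := by
    have h₁ := re_inner_eq_norm_add_mul_self_sub_norm_sub_mul_self_div_four (𝕜 := ℂ) x y
    have h₂ := re_inner_eq_norm_add_mul_self_sub_norm_sub_mul_self_div_four (𝕜 := ℂ) (J x) (J y)
    rw [← map_add, ← map_sub, J.norm_map, J.norm_map, ← h₁] at h₂
    exact h₂
  rw [← inner_conj_symm y x]
  refine Complex.ext ((hre x y).trans (Complex.conj_re _).symm) ?_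
  have h := hre (Complex.I • x) y
  rw [map_smulₛₗ, inner_smul_left, inner_smul_left] at h
  simp only [Complex.conj_I, Complex.neg_re, Complex.mul_re, Complex.I_re, Complex.I_im, map_neg,
    neg_neg, neg_mul] at h
  rw [Complex.conj_im]
  linarith

theorem re_inner_graph_nonneg {D : E →ₗ.[ℂ] E} (h : ∀ x : D.domain, 0 ≤ (⟪(x : E), D x⟫_ℂ).re)
    {x y : E} (hxy : (x, y) ∈ D.graph) : 0 ≤ (⟪x, y⟫_ℂ).re := by
  obtain ⟨z, rfl, rfl⟩ := LinearPMap.mem_graph_iff D |>.1 hxy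
  exact h z

/-! ### Resolvents of self-adjoint operators and uniqueness of positive square roots. -/

variable [CompleteSpace E]

theorem mem_graph_iff_of_isSelfAdjoint {D : E →ₗ.[ℂ] E} (hD : IsSelfAdjoint D) {y z : E} :
    (y, z) ∈ D.graph ↔ ∀ a b, (a, b) ∈ D.graph → ⟪b, y⟫_ℂ = ⟪a, z⟫_ℂ := by
  have h := LinearPMap.adjoint_graph_eq_graph_adjoint hD.dense_domain
  rw [LinearPMap.isSelfAdjoint_def.1 hD] at h
  conv_lhs => rw [h, Submodule.mem_adjoint_iff]
  simp only [sub_eq_zero]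

/-- Von Neumann's argument: project `(y, 0)` onto the closed graph of `D`. If `(v, u)` is the
projection, orthogonality of `(y - v, -u)` to the graph says that `(u, y - v)` lies in the graph of
`D* = D`, so `v = (1 + D²)⁻¹ y` and `u = D v`. -/
theorem exists_resolvent_apply {D : E →ₗ.[ℂ] E} (hD : IsSelfAdjoint D) (y : E) :
    ∃ v u, (v, u) ∈ D.graph ∧ (u, y - v) ∈ D.graph := by
  let W : Submodule ℂ (WithLp 2 (E × E)) :=
    D.graph.comap (WithLp.linearEquiv 2 ℂ (E × E)).toLinearMap
  have hW : IsClosed (W : Set (WithLp 2 (E × E))) :=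
    hD.isClosed.preimage (WithLp.prod_continuous_ofLp 2 E E)
  have : CompleteSpace W := hW.completeSpace_coe
  let p := W.starProjection (WithLp.toLp 2 (y, 0))
  have hp : p ∈ W := W.starProjection_apply_mem _
  refine ⟨p.fst, p.snd, hp, (mem_graph_iff_of_isSelfAdjoint hD).2 fun a b hab => ?_⟩
  have h := W.starProjection_inner_eq_zero (WithLp.toLp 2 (y, 0)) (WithLp.toLp 2 (a, b)) hab
  rw [← inner_conj_symm, starRingEnd_apply, star_eq_zero, WithLp.prod_inner_apply] at h
  have h' : ⟪a, y - p.fst⟫_ℂ + ⟪b, 0 - p.snd⟫_ℂ = 0 := h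
  rw [zero_sub, inner_neg_right] at h'
  linear_combination -h'

theorem norm_sq_add_norm_sq_resolvent {D : E →ₗ.[ℂ] E} (hD : IsSelfAdjoint D) {y v u : E}
    (h₁ : (v, u) ∈ D.graph) (h₂ : (u, y - v) ∈ D.graph) :
    ((‖u‖ ^ 2 + ‖v‖ ^ 2 : ℝ) : ℂ) = ⟪v, y⟫_ℂ := by
  have h := (mem_graph_iff_of_isSelfAdjoint hD).1 h₂ _ _ h₁
  rw [inner_sub_right, inner_self_eq_norm_sq_to_K, inner_self_eq_norm_sq_to_K] at h
  push_cast
  linear_combination h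

theorem norm_le_resolvent {D : E →ₗ.[ℂ] E} (hD : IsSelfAdjoint D) {y v u : E}
    (h₁ : (v, u) ∈ D.graph) (h₂ : (u, y - v) ∈ D.graph) : ‖v‖ ≤ ‖y‖ ∧ ‖u‖ ≤ ‖y‖ := by
  have h := congrArg (‖·‖) (norm_sq_add_norm_sq_resolvent hD h₁ h₂)
  have hi := norm_inner_le_norm (𝕜 := ℂ) v y
  simp only [Complex.norm_real, Real.norm_eq_abs] at h
  rw [abs_of_nonneg (by positivity)] at h
  have hv : ‖v‖ ≤ ‖y‖ := by
    by_contra! hlt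
    nlinarith [norm_nonneg v, norm_nonneg y, norm_nonneg u, sq_nonneg ‖u‖]
  refine ⟨hv, ?_⟩
  by_contra! hlt
  nlinarith [norm_nonneg v, norm_nonneg y, norm_nonneg u, sq_nonneg (‖v‖ - ‖y‖)]

theorem resolvent_unique {D : E →ₗ.[ℂ] E} (hD : IsSelfAdjoint D) {y v u v' u' : E}
    (h₁ : (v, u) ∈ D.graph) (h₂ : (u, y - v) ∈ D.graph)
    (h₁' : (v', u') ∈ D.graph) (h₂' : (u', y - v') ∈ D.graph) : v = v' ∧ u = u' := by
  have a₁ : (v - v', u - u') ∈ D.graph := sub_mem h₁ h₁'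
  have a₂ : (u - u', (0 : E) - (v - v')) ∈ D.graph := by
    have := sub_mem h₂ h₂'
    rwa [Prod.mk_sub_mk, show y - v - (y - v') = 0 - (v - v') by abel] at this
  have := norm_le_resolvent hD a₁ a₂
  rw [norm_zero, norm_le_zero_iff, norm_le_zero_iff, sub_eq_zero, sub_eq_zero] at this
  exact this

/-- The bounded operators `B = (1 + D²)⁻¹` and `R = D (1 + D²)⁻¹` of a positive self-adjoint
operator `D`. -/
theorem exists_resolvent {D : E →ₗ.[ℂ] E} (hD : IsSelfAdjoint D)
    (hpos : ∀ x : D.domain, 0 ≤ (⟪(x : E), D x⟫_ℂ).re) :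
    ∃ B R : E →L[ℂ] E, 0 ≤ R ∧ (∀ y, (B y, R y) ∈ D.graph) ∧ (∀ y, (R y, y - B y) ∈ D.graph) ∧
      R * R = B - B * B := by
  choose B R h₁ h₂ using exists_resolvent_apply hD
  have hadd (y z : E) : B (y + z) = B y + B z ∧ R (y + z) = R y + R z := by
    refine resolvent_unique hD (h₁ _) (h₂ _) (add_mem (h₁ y) (h₁ z)) ?_
    have := add_mem (h₂ y) (h₂ z)
    rwa [Prod.mk_add_mk, sub_add_sub_comm] at this
  have hsmul (c : ℂ) (y : E) : B (c • y) = c • B y ∧ R (c • y) = c • R y := by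
    refine resolvent_unique hD (h₁ _) (h₂ _) (Submodule.smul_mem _ c (h₁ y)) ?_
    have := Submodule.smul_mem _ c (h₂ y)
    rwa [Prod.smul_mk, smul_sub] at this
  let B' : E →L[ℂ] E := LinearMap.mkContinuous
    { toFun := B, map_add' := fun y z => (hadd y z).1, map_smul' := fun c y => (hsmul c y).1 } 1
    fun y => by simpa using (norm_le_resolvent hD (h₁ y) (h₂ y)).1
  let R' : E →L[ℂ] E := LinearMap.mkContinuous
    { toFun := R, map_add' := fun y z => (hadd y z).2, map_smul' := fun c y => (hsmul c y).2 } 1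
    fun y => by simpa using (norm_le_resolvent hD (h₁ y) (h₂ y)).2
  refine ⟨B', R', ?_, h₁, h₂, ?_⟩
  · rw [ContinuousLinearMap.nonneg_iff_isPositive, ContinuousLinearMap.isPositive_def]
    have hsub (w : E) : w = B w + (w - B w) := by abel
    refine ⟨fun w w' => ?_, fun w => ?_⟩
    · change ⟪R w, w'⟫_ℂ = ⟪w, R w'⟫_ℂ
      rw [hsub w, hsub w', inner_add_right, inner_add_left, ← hsub, ← hsub,
        (mem_graph_iff_of_isSelfAdjoint hD).1 (h₁ w') _ _ (h₁ w),
        (mem_graph_iff_of_isSelfAdjoint hD).1 (h₂ w') _ _ (h₂ w)]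
    · change 0 ≤ (⟪R w, w⟫_ℂ).re
      have h : ⟪R w, w⟫_ℂ = ⟪B w, R w⟫_ℂ + ⟪R w, w - B w⟫_ℂ := by
        rw [← (mem_graph_iff_of_isSelfAdjoint hD).1 (h₁ w) _ _ (h₁ w), ← inner_add_right, ← hsub]
      rw [h, Complex.add_re]
      exact add_nonneg (re_inner_graph_nonneg hpos (h₁ w)) (re_inner_graph_nonneg hpos (h₂ w))
  · ext w
    change R (R w) = B w - B (B w)
    -- Both `(B R w, R R w)` and `(R B w, B w - B B w)` solve the resolvent equation with right-hand
    -- side `R w`.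
    exact (resolvent_unique hD (h₁ (R w)) (h₂ (R w)) (h₂ (B w))
      (sub_mem (h₁ w) (h₁ (B w)))).2

/-- The unbounded `D` is recovered from its bounded transforms. If `D x = z`, then `R x = B z` since
`D` commutes with its resolvent. Conversely, `R x = B z` forces `x = B x + R z`, and `D` of the
right-hand side is `R x + (z - B z) = z`. -/
theorem mem_graph_iff_resolvent {D : E →ₗ.[ℂ] E} (hD : IsSelfAdjoint D) {B R : E →L[ℂ] E}
    (h₁ : ∀ y, (B y, R y) ∈ D.graph) (h₂ : ∀ y, (R y, y - B y) ∈ D.graph) {x z : E} :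
    (x, z) ∈ D.graph ↔ R x = B z := by
  constructor
  · intro h
    exact (resolvent_unique hD (h₂ x) (sub_mem h (h₁ x)) (h₁ z) (h₂ z)).1
  · intro h
    have hx : x - B x = R z := by
      have := sub_mem (h₂ x) (h₁ z)
      rw [Prod.mk_sub_mk, h, sub_self] at this
      exact sub_eq_zero.1 (D.graph_fst_eq_zero_snd this rfl)
    have := add_mem (h₁ x) (h₂ z)
    rwa [← hx, Prod.mk_add_mk, h, add_sub_cancel, add_sub_cancel] at this

/-- The square `D²` determines `B = (1 + D²)⁻¹`; then `R = D B` is the unique positive square root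
of the bounded operator `B - B²`, and `B` and `R` determine the graph of `D`. This avoids the
spectral theorem for unbounded operators. -/
theorem IsPositiveSqrt.unique {D D' : E →ₗ.[ℂ] E} {G : SetRel E E} (h : IsPositiveSqrt D G)
    (h' : IsPositiveSqrt D' G) : D = D' := by
  obtain ⟨B, R, hR, h₁, h₂, hsq⟩ := exists_resolvent h.isSelfAdjoint h.nonneg
  obtain ⟨B', R', hR', h₁', h₂', hsq'⟩ := exists_resolvent h'.isSelfAdjoint h'.nonneg
  have hB : B = B' := by
    ext y
    have hG : (B y, y - B y) ∈ (D'.graph : SetRel E E) ○ (D'.graph : SetRel E E) := by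
      rw [h'.sq_eq, ← h.sq_eq]
      exact ⟨R y, h₁ y, h₂ y⟩
    obtain ⟨u, hu, hu'⟩ := hG
    exact (resolvent_unique h'.isSelfAdjoint hu hu' (h₁' y) (h₂' y)).1
  subst hB
  have hRR : R = R' := by
    rw [← CFC.sqrt_unique hsq hR, ← CFC.sqrt_unique hsq' hR']
  subst hRR
  refine LinearPMap.eq_of_eq_graph (SetLike.ext fun ⟨x, z⟩ => ?_)
  rw [mem_graph_iff_resolvent h.isSelfAdjoint h₁ h₂,
    mem_graph_iff_resolvent h'.isSelfAdjoint h₁' h₂']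

/-- If `G = J D` with `J` antiunitary and `D` self-adjoint, then `G* G = D²`. -/
theorem comp_antilinearAdjoint_eq {D : E →ₗ.[ℂ] E} (hD : IsSelfAdjoint D)
    (J : E ≃ₛₗᵢ[starRingEnd ℂ] E) {G : SetRel E E}
    (hG : G = {z | ∃ x : D.domain, z = ((x : E), J (D x))}) :
    G ○ antilinearAdjoint G = (D.graph : SetRel E E) ○ (D.graph : SetRel E E) := by
  have hmem (x y : E) : (x, y) ∈ G ↔ (x, J.symm y) ∈ D.graph := by
    rw [hG, LinearPMap.mem_graph_iff]
    constructor
    · rintro ⟨z, hz⟩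
      obtain ⟨rfl, rfl⟩ := Prod.mk.inj hz
      exact ⟨z, rfl, by simp⟩
    · rintro ⟨z, rfl, hz⟩
      exact ⟨z, by simp_all⟩
  have hJ (x y : E) : ⟪x, J y⟫_ℂ = ⟪y, J.symm x⟫_ℂ := by
    have := inner_map_map_of_antiunitary J.toLinearIsometry (J.symm x) y
    simpa using this
  have hadj (y z : E) : (y, z) ∈ antilinearAdjoint G ↔ (J.symm y, z) ∈ D.graph := by
    rw [mem_graph_iff_of_isSelfAdjoint hD]
    constructor
    · intro h a b hab
      have := h (a, J b) ((hmem _ _).2 (by simpa using hab))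
      rwa [hJ] at this
    · rintro h ⟨a, b⟩ hab
      have := h _ _ ((hmem _ _).1 hab)
      rw [← this]
      change ⟪y, b⟫_ℂ = _
      conv_lhs => rw [← J.apply_symm_apply b, hJ]
  ext ⟨x, z⟩
  constructor
  · rintro ⟨y, hy, hz⟩
    exact ⟨J.symm y, (hmem _ _).1 hy, (hadj _ _).1 hz⟩
  · rintro ⟨y, hy, hz⟩
    exact ⟨J y, (hmem _ _).2 (by simpa using hy), (hadj _ _).2 (by simpa using hz)⟩

/-! ### Quotients of commuting bounded self-adjoint operators. -/

/-- The graph of `c b⁻¹`. -/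
def quotientGraph (b c : E →L[ℂ] E) : Submodule ℂ (E × E) :=
  LinearMap.ker ((b : E →ₗ[ℂ] E).comp (LinearMap.snd ℂ E E) -
    (c : E →ₗ[ℂ] E).comp (LinearMap.fst ℂ E E))

omit [CompleteSpace E] in
theorem mem_quotientGraph {b c : E →L[ℂ] E} {x y : E} :
    (x, y) ∈ quotientGraph b c ↔ b y = c x := by
  simp [quotientGraph, sub_eq_zero]

/-- The operator `c b⁻¹`, for injective `b`. -/
def quotientOp (b c : E →L[ℂ] E) : E →ₗ.[ℂ] E :=
  (quotientGraph b c).toLinearPMap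

/-- Commuting self-adjoint operators `b`, `c` with `b` injective and `b c ≥ 0`. -/
structure IsQuotientPair (b c : E →L[ℂ] E) : Prop where
  selfAdjoint_left : IsSelfAdjoint b
  selfAdjoint_right : IsSelfAdjoint c
  commute : Commute b c
  injective : Function.Injective b
  nonneg : ∀ w, 0 ≤ (⟪b w, c w⟫_ℂ).re

variable {b c : E →L[ℂ] E}

theorem IsQuotientPair.mem_graph (h : IsQuotientPair b c) {x y : E} :
    (x, y) ∈ (quotientOp b c).graph ↔ b y = c x := by
  rw [quotientOp, Submodule.toLinearPMap_graph_eq, mem_quotientGraph]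
  rintro ⟨x, y⟩ hxy (rfl : x = 0)
  rw [mem_quotientGraph, map_zero] at hxy
  exact h.injective (hxy.trans (map_zero b).symm)

theorem denseRange_of_injective (hb : IsSelfAdjoint b) (hi : Function.Injective b) :
    DenseRange b := by
  have h : (LinearMap.range (b : E →ₗ[ℂ] E)).topologicalClosure = ⊤ := by
    rw [Submodule.topologicalClosure_eq_top_iff, Submodule.eq_bot_iff]
    intro x hx
    refine hi ?_
    rw [map_zero, ← inner_self_eq_zero (𝕜 := ℂ), ← ContinuousLinearMap.adjoint_inner_right,
      hb.adjoint_eq]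
    have := (Submodule.mem_orthogonal _ _).1 hx (b (b x)) ⟨b x, rfl⟩
    rwa [← inner_conj_symm, map_eq_zero]
  exact Submodule.dense_iff_topologicalClosure_eq_top.2 h

theorem IsQuotientPair.apply_comm (h : IsQuotientPair b c) (x : E) : b (c x) = c (b x) :=
  congrArg (fun T : E →L[ℂ] E => T x) h.commute.eq

theorem inner_apply_of_isSelfAdjoint {b : E →L[ℂ] E} (hb : IsSelfAdjoint b) (x y : E) :
    ⟪b x, y⟫_ℂ = ⟪x, b y⟫_ℂ := by
  rw [← ContinuousLinearMap.adjoint_inner_right, hb.adjoint_eq]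

/-- The vectors `(b w, c w)` form a core, even for `w` in a dense set. A vector `(y, z)` of the
graph orthogonal to all of them satisfies `b z = c y` and `b y + c z = 0`; hence `b² y + c² y = 0`,
so `b y = 0` and `y = z = 0` by injectivity of `b`. -/
theorem IsQuotientPair.graph_eq_closure (h : IsQuotientPair b c) {s : Set E} (hs : Dense s) :
    ((quotientOp b c).graph : Set (E × E)) = closure ((fun w => (b w, c w)) '' s) := by
  have hcont : Continuous fun w => (b w, c w) := by fun_prop
  have hclosed : IsClosed ((quotientOp b c).graph : Set (E × E)) := by
    have : ((quotientOp b c).graph : Set (E × E)) = {z | b z.2 = c z.1} :=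
      Set.ext fun _ => h.mem_graph
    rw [this]
    exact isClosed_eq (by fun_prop) (by fun_prop)
  refine Set.Subset.antisymm ?_ (closure_minimal ?_ hclosed)
  · rintro ⟨y, z⟩ hyz
    let f : E →ₗ[ℂ] WithLp 2 (E × E) := (WithLp.linearEquiv 2 ℂ (E × E)).symm.toLinearMap.comp
      ((b : E →ₗ[ℂ] E).prod (c : E →ₗ[ℂ] E))
    let W := (LinearMap.range f).topologicalClosure
    have : CompleteSpace W := (LinearMap.range f).isClosed_topologicalClosure.completeSpace_coe
    have hWr : (W : Set (WithLp 2 (E × E))) = closure (Set.range f) := rfl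
    have hW : ∀ p ∈ W, (p.fst, p.snd) ∈ closure ((fun w => (b w, c w)) '' s) := by
      intro p hp
      have h₁ : p.ofLp ∈ closure (Set.range fun w => (b w, c w)) := by
        have := image_closure_subset_closure_image (s := Set.range f)
          (WithLp.prod_continuous_ofLp 2 E E) ⟨p, hp, rfl⟩
        rwa [← Set.range_comp] at this
      refine closure_minimal ?_ isClosed_closure h₁
      rintro _ ⟨w, rfl⟩
      exact image_closure_subset_closure_image hcont ⟨w, hs w, rfl⟩
    have hgr : closure ((fun w => (b w, c w)) '' s) ⊆ (quotientOp b c).graph := by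
      refine closure_minimal ?_ hclosed
      rintro _ ⟨w, -, rfl⟩
      exact h.mem_graph.2 (h.apply_comm w)
    let p := W.starProjection (WithLp.toLp 2 (y, z))
    have hpW := hW p (W.starProjection_apply_mem _)
    have hd : (y - p.fst, z - p.snd) ∈ (quotientOp b c).graph := sub_mem hyz (hgr hpW)
    have hd₁ := h.mem_graph.1 hd
    have hd₂ : b (y - p.fst) + c (z - p.snd) = 0 := by
      refine ext_inner_right ℂ fun w => ?_
      have hw := W.starProjection_inner_eq_zero (WithLp.toLp 2 (y, z)) (f w)
        (subset_closure ⟨w, rfl⟩)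
      rw [WithLp.prod_inner_apply] at hw
      rw [inner_add_left, inner_apply_of_isSelfAdjoint h.selfAdjoint_left,
        inner_apply_of_isSelfAdjoint h.selfAdjoint_right, inner_zero_left]
      exact hw
    have hy : y - p.fst = 0 := by
      refine h.injective ?_
      rw [map_zero, ← norm_eq_zero, ← pow_eq_zero_iff two_ne_zero]
      have h₃ : ⟪b (y - p.fst), b (y - p.fst)⟫_ℂ + ⟪c (y - p.fst), c (y - p.fst)⟫_ℂ = 0 := by
        rw [inner_apply_of_isSelfAdjoint h.selfAdjoint_left,
          inner_apply_of_isSelfAdjoint h.selfAdjoint_right, ← inner_add_right, ← hd₁,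
          ← h.apply_comm, ← map_add, hd₂, map_zero, inner_zero_right]
      have h₄ := congrArg RCLike.re h₃
      rw [map_add, inner_self_eq_norm_sq (𝕜 := ℂ), inner_self_eq_norm_sq (𝕜 := ℂ), map_zero] at h₄
      nlinarith [sq_nonneg ‖c (y - p.fst)‖, norm_nonneg (b (y - p.fst))]
    have hz : z - p.snd = 0 := by
      refine h.injective ?_
      rw [hd₁, hy, map_zero, map_zero]
    rw [sub_eq_zero.1 hy, sub_eq_zero.1 hz]
    exact hpW
  · rintro _ ⟨w, -, rfl⟩
    exact h.mem_graph.2 (h.apply_comm w)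

theorem IsQuotientPair.dense_domain (h : IsQuotientPair b c) :
    Dense ((quotientOp b c).domain : Set E) := by
  refine (denseRange_of_injective h.selfAdjoint_left h.injective).mono ?_
  rintro _ ⟨x, rfl⟩
  exact LinearPMap.mem_domain_of_mem_graph (h.mem_graph.2 (h.apply_comm x) : (b x, c x) ∈ _)

theorem IsQuotientPair.graph_induction (h : IsQuotientPair b c) {p : E × E → Prop}
    (hp : IsClosed {z | p z}) (hw : ∀ w, p (b w, c w)) {z : E × E}
    (hz : z ∈ (quotientOp b c).graph) : p z := by
  have hz' : z ∈ closure ((fun w => (b w, c w)) '' Set.univ) := by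
    rw [← h.graph_eq_closure dense_univ]; exact hz
  exact closure_minimal (t := {z | p z}) (by rintro _ ⟨w, -, rfl⟩; exact hw w) hp hz'

/-- By the core property it suffices to test the adjoint relation on `(b w, c w)`, and there it
reads `c y = b z`, the equation of the graph itself. -/
theorem IsQuotientPair.isSelfAdjoint (h : IsQuotientPair b c) :
    IsSelfAdjoint (quotientOp b c) := by
  rw [LinearPMap.isSelfAdjoint_def]
  refine LinearPMap.eq_of_eq_graph (SetLike.ext fun ⟨y, z⟩ => ?_)
  rw [LinearPMap.adjoint_graph_eq_graph_adjoint h.dense_domain, Submodule.mem_adjoint_iff]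
  simp only [sub_eq_zero]
  constructor
  · intro hyz
    rw [h.mem_graph]
    refine ext_inner_left ℂ fun w => ?_
    rw [← inner_apply_of_isSelfAdjoint h.selfAdjoint_left,
      ← inner_apply_of_isSelfAdjoint h.selfAdjoint_right]
    exact (hyz _ _ (h.mem_graph.2 (h.apply_comm w))).symm
  · intro hyz x x' hx
    refine h.graph_induction (p := fun z' => ⟪z'.2, y⟫_ℂ = ⟪z'.1, z⟫_ℂ)
      (isClosed_eq (by fun_prop) (by fun_prop)) (fun w => ?_) hx
    simp only
    rw [inner_apply_of_isSelfAdjoint h.selfAdjoint_left,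
      inner_apply_of_isSelfAdjoint h.selfAdjoint_right, h.mem_graph.1 hyz]

theorem IsQuotientPair.re_inner_nonneg (h : IsQuotientPair b c) (x : (quotientOp b c).domain) :
    0 ≤ (⟪(x : E), quotientOp b c x⟫_ℂ).re :=
  h.graph_induction (p := fun z => 0 ≤ (⟪z.1, z.2⟫_ℂ).re)
    (isClosed_le (by fun_prop) (by fun_prop)) h.nonneg (LinearPMap.mem_graph _ x)

theorem IsQuotientPair.isPositiveSqrt (h : IsQuotientPair b c) (J : E ≃ₛₗᵢ[starRingEnd ℂ] E)
    {G : SetRel E E}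
    (hG : G = {z | ∃ x : (quotientOp b c).domain, z = ((x : E), J (quotientOp b c x))}) :
    IsPositiveSqrt (quotientOp b c) (G ○ antilinearAdjoint G) :=
  ⟨h.isSelfAdjoint, h.re_inner_nonneg, (comp_antilinearAdjoint_eq h.isSelfAdjoint J hG).symm⟩

/-- The polar decomposition `J (c b⁻¹)` of the closure of `b w ↦ J (c w)`. -/
theorem IsQuotientPair.closure_eq (h : IsQuotientPair b c) (J : E ≃ₛₗᵢ[starRingEnd ℂ] E)
    {s : Set E} (hs : Dense s) :
    closure ((fun w => (b w, J (c w))) '' s) =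
      {z | ∃ x : (quotientOp b c).domain, z = ((x : E), J (quotientOp b c x))} := by
  let Φ : E × E ≃ₜ E × E := (Homeomorph.refl E).prodCongr J.toHomeomorph
  have h₁ : (fun w => (b w, J (c w))) '' s = Φ '' ((fun w => (b w, c w)) '' s) := by
    rw [Set.image_image]; rfl
  rw [h₁, ← Φ.image_closure, ← h.graph_eq_closure hs]
  ext ⟨x, y⟩
  constructor
  · rintro ⟨⟨x', y'⟩, hxy, hΦ⟩
    obtain ⟨z, rfl, rfl⟩ := (LinearPMap.mem_graph_iff _).1 hxy
    exact ⟨z, hΦ.symm⟩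
  · rintro ⟨z, hz⟩
    exact ⟨_, LinearPMap.mem_graph _ z, hz.symm⟩

end Unbounded

/-! ### Second quantization of contractions -/

section SecondQuantization

variable {K : Type*} [NormedAddCommGroup K] [InnerProductSpace ℂ K]

theorem map_wedgeLeft (A : K →L[ℂ] K) (p : K) (x : ExteriorAlgebra ℂ K) :
    ExteriorAlgebra.map (A : K →ₗ[ℂ] K) (wedgeLeft p x)
      = wedgeLeft (A p) (ExteriorAlgebra.map (A : K →ₗ[ℂ] K) x) := by
  simp [wedgeLeft]

/-- `p₁ ∧ ⋯ ∧ pₙ ↦ A p₁ ∧ ⋯ ∧ A pₙ` on the space with scalar product. -/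
def PreFock.map (A : K →L[ℂ] K) : PreFock K →ₗ[ℂ] PreFock K :=
  (ExteriorAlgebra.map (A : K →ₗ[ℂ] K)).toLinearMap

/-- The bound is crude, but it is uniform over all contractions; applied to the powers of one
contraction it is the input to the power trick of `norm_map_le_of_isSelfAdjoint`. -/
theorem exists_norm_map_le (x : ExteriorAlgebra ℂ K) :
    ∃ M : ℝ, ∀ A : K →L[ℂ] K, ‖A‖ ≤ 1 →
      ‖PreFock.map A (x : PreFock K)‖ ≤ M := by
  induction x using wedge_induction with
  | h1 =>
    refine ⟨‖PreFock.unit K‖, fun A _ => le_of_eq (congrArg _ ?_)⟩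
    exact map_one (ExteriorAlgebra.map (A : K →ₗ[ℂ] K))
  | hs c x hx =>
    obtain ⟨M, hM⟩ := hx
    refine ⟨‖c‖ * M, fun A hA => ?_⟩
    refine (congrArg norm ((PreFock.map A).map_smul c x)).trans_le ?_
    exact (norm_smul c (PreFock.map A x)).trans_le
      (mul_le_mul_of_nonneg_left (hM A hA) (norm_nonneg c))
  | ha x y hx hy =>
    obtain ⟨M, hM⟩ := hx
    obtain ⟨N, hN⟩ := hy
    refine ⟨M + N, fun A hA => ?_⟩
    refine (congrArg norm ((PreFock.map A).map_add x y)).trans_le ?_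
    exact (norm_add_le (E := PreFock K) _ _).trans (add_le_add (hM A hA) (hN A hA))
  | hw p x hx =>
    obtain ⟨M, hM⟩ := hx
    refine ⟨‖p‖ * M, fun A hA => ?_⟩
    refine (congrArg (norm (E := PreFock K)) (map_wedgeLeft A p x)).trans_le ?_
    refine (PreFock.norm_wedge_le _ _).trans
      (mul_le_mul (A.le_of_opNorm_le hA p |>.trans (one_mul _).le) (hM A hA) (norm_nonneg _)
        (norm_nonneg _))

variable [CompleteSpace K]

theorem contract_map (A : K →L[ℂ] K) (p : K) (x : ExteriorAlgebra ℂ K) :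
    contract p (ExteriorAlgebra.map (A : K →ₗ[ℂ] K) x)
      = ExteriorAlgebra.map (A : K →ₗ[ℂ] K) (contract (star A p) x) := by
  induction x using wedge_induction with
  | h1 => simp [contract_one]
  | hs c x hx => simp only [map_smul, hx]
  | ha x y hx hy => simp only [map_add, hx, hy]
  | hw r x hx =>
    rw [map_wedgeLeft, contract_wedgeLeft, contract_wedgeLeft, hx, map_sub, map_smul, map_wedgeLeft,
      ContinuousLinearMap.star_eq_adjoint, ContinuousLinearMap.adjoint_inner_left]

theorem wedgeInner_map (A : K →L[ℂ] K) (x y : ExteriorAlgebra ℂ K) :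
    wedgeInner (ExteriorAlgebra.map (A : K →ₗ[ℂ] K) x) y
      = wedgeInner x (ExteriorAlgebra.map ((star A : K →L[ℂ] K) : K →ₗ[ℂ] K) y) := by
  induction x using wedge_induction generalizing y with
  | h1 =>
    rw [map_one, wedgeInner_one, wedgeInner_one]
    induction y using wedge_induction with
    | h1 => simp
    | hs c y hy => rw [map_smul, map_smul, map_smul, hy]
    | ha y z hy hz => rw [map_add, map_add, map_add, hy, hz]
    | hw p y hy =>
      rw [map_wedgeLeft]
      simp [wedgeLeft, ExteriorAlgebra.algebraMapInv]
  | hs c x hx => rw [map_smul, wedgeInner_smul_left, wedgeInner_smul_left, hx]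
  | ha x y hx hy => rw [map_add, wedgeInner_add_left, wedgeInner_add_left, hx, hy]
  | hw p x hx =>
    rw [map_wedgeLeft, wedgeInner_wedge_left, wedgeInner_wedge_left, hx, contract_map, star_star]

omit [CompleteSpace K] in
theorem map_mul_apply (A B : K →L[ℂ] K) (x : ExteriorAlgebra ℂ K) :
    ExteriorAlgebra.map ((A * B : K →L[ℂ] K) : K →ₗ[ℂ] K) x
      = ExteriorAlgebra.map (A : K →ₗ[ℂ] K) (ExteriorAlgebra.map (B : K →ₗ[ℂ] K) x) := by
  rw [← AlgHom.comp_apply, ExteriorAlgebra.map_comp_map]; rfl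

theorem norm_map_sq_le (A : K →L[ℂ] K) (x : PreFock K) :
    ‖PreFock.map A x‖ ^ 2 ≤ ‖x‖ *
      ‖PreFock.map (star A * A) x‖ := by
  have h : ⟪PreFock.map A x,
      PreFock.map A x⟫_ℂ = ⟪x,
      PreFock.map (star A * A) x⟫_ℂ := by
    rw [PreFock.inner_def, PreFock.inner_def]
    exact (wedgeInner_map A x _).trans (congrArg (wedgeInner (K := K) x) (map_mul_apply _ A x).symm)
  rw [← inner_self_eq_norm_sq (𝕜 := ℂ), h]
  exact (RCLike.re_le_norm _).trans (norm_inner_le_norm _ _)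

/-- Cauchy–Schwarz gives `f k ^ 2 ≤ ‖x‖ f (2k)` for `f k`, the norm of the image of `x` under the
second quantization of `A ^ k`. By iteration `(f 1 / ‖x‖) ^ (2 ^ n)` stays below a bound independent
of `n`, so the ratio is at most `1`. -/
theorem norm_map_le_of_isSelfAdjoint {A : K →L[ℂ] K} (hs : IsSelfAdjoint A) (hA : ‖A‖ ≤ 1)
    (x : PreFock K) :
    ‖PreFock.map A x‖ ≤ ‖x‖ := by
  obtain ⟨M, hM⟩ := exists_norm_map_le x
  let f (k : ℕ) : ℝ := ‖PreFock.map (A ^ k) x‖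
  have hf (k : ℕ) : f k ^ 2 ≤ ‖x‖ * f (2 * k) := by
    have := norm_map_sq_le (A ^ k) x
    rwa [(hs.pow k).star_eq, ← pow_add, ← two_mul] at this
  have hfM (k : ℕ) : f k ≤ M := by
    refine hM _ ?_
    induction k with
    | zero => rw [pow_zero]; exact ContinuousLinearMap.norm_id_le
    | succ k ih =>
      rw [pow_succ]
      exact (norm_mul_le _ _).trans (mul_le_one₀ ih (norm_nonneg _) hA)
  have hf0 (k : ℕ) : 0 ≤ f k := norm_nonneg _
  have hf1 : f 1 = ‖PreFock.map A x‖ := by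
    simp only [f, pow_one]
  rw [← hf1]
  by_contra! hlt
  have hx := norm_nonneg (x : PreFock K)
  rcases hx.eq_or_lt with hx | hx
  -- The algebraic Fock space carries only a seminorm here, so `‖x‖ = 0` is treated through the
  -- inequality rather than by `x = 0`.
  · have := hf 1
    rw [← hx, zero_mul] at this
    nlinarith
  have hr (n : ℕ) : (f 1 / ‖x‖) ^ (2 ^ n) ≤ f (2 ^ n) / ‖x‖ := by
    induction n with
    | zero => simp
    | succ n ih =>
      rw [pow_succ 2 n, pow_mul]
      refine (pow_le_pow_left₀ (by positivity) ih 2).trans ?_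
      rw [div_pow, div_le_div_iff₀ (by positivity) hx, mul_comm (2 ^ n) 2]
      nlinarith [hf (2 ^ n)]
  obtain ⟨n, hn⟩ := pow_unbounded_of_one_lt (M / ‖x‖) ((one_lt_div hx).2 hlt)
  have h₁ := pow_le_pow_right₀ ((one_lt_div hx).2 hlt).le (Nat.lt_two_pow_self (n := n)).le
  have h₂ := div_le_div_of_nonneg_right (hfM (2 ^ n)) hx.le
  linarith [hr n]

/-- Reduction to the self-adjoint contraction `A* A`. -/
theorem norm_map_le {A : K →L[ℂ] K} (hA : ‖A‖ ≤ 1) (x : PreFock K) :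
    ‖PreFock.map A x‖ ≤ ‖x‖ := by
  have h₁ := norm_map_sq_le A x
  have hn : ‖star A * A‖ ≤ 1 :=
    (norm_mul_le _ _).trans (mul_le_one₀ ((norm_star A).trans_le hA) (norm_nonneg _) hA)
  have h₂ := norm_map_le_of_isSelfAdjoint (IsSelfAdjoint.star_mul_self A) hn x
  refine abs_le_of_sq_le_sq' ?_ (norm_nonneg _) |>.2
  rw [sq ‖x‖]
  exact h₁.trans (mul_le_mul_of_nonneg_left h₂ (norm_nonneg _))

/-- The second quantization `p₁ ∧ ⋯ ∧ pₙ ↦ A p₁ ∧ ⋯ ∧ A pₙ` of a contraction `A`. -/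
def fockMap (A : K →L[ℂ] K) (hA : ‖A‖ ≤ 1) : Fock K →L[ℂ] Fock K :=
  ContinuousLinearMap.completion
    ((PreFock.map A).mkContinuous 1 fun x => (norm_map_le hA x).trans (one_mul _).ge)

theorem fockMap_coe (A : K →L[ℂ] K) (hA : ‖A‖ ≤ 1) (x : PreFock K) :
    fockMap A hA (x : Fock K) = (PreFock.map A x : Fock K) :=
  ContinuousLinearMap.completion_apply_coe _ _

theorem fockMap_isSelfAdjoint {A : K →L[ℂ] K} (hA : ‖A‖ ≤ 1) (hs : IsSelfAdjoint A) :
    IsSelfAdjoint (fockMap A hA) := by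
  rw [ContinuousLinearMap.isSelfAdjoint_iff_isSymmetric]
  intro x y
  change ⟪fockMap A hA x, y⟫_ℂ = ⟪x, fockMap A hA y⟫_ℂ
  induction x, y using UniformSpace.Completion.induction_on₂ with
  | hp => exact isClosed_eq (by fun_prop) (by fun_prop)
  | ih x y =>
    rw [fockMap_coe, fockMap_coe, UniformSpace.Completion.inner_coe,
      UniformSpace.Completion.inner_coe]
    refine (wedgeInner_map A x y).trans ?_
    rw [hs.star_eq]
    rfl

theorem fockMap_mul {A B C : K →L[ℂ] K} (hA : ‖A‖ ≤ 1) (hB : ‖B‖ ≤ 1) (hC : ‖C‖ ≤ 1)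
    (h : A * B = C) : fockMap A hA * fockMap B hB = fockMap C hC := by
  subst h
  ext x
  change fockMap A hA (fockMap B hB x) = _
  induction x using UniformSpace.Completion.induction_on with
  | hp => exact isClosed_eq (by fun_prop) (by fun_prop)
  | ih x =>
    rw [fockMap_coe, fockMap_coe, fockMap_coe]
    exact congrArg _ (map_mul_apply A B x).symm

end SecondQuantization

/-! ### Second quantization of antiunitary involutions, with reversal of the wedge products -/

section Reversal

variable {K : Type*} [NormedAddCommGroup K] [InnerProductSpace ℂ K]

/-- The parity automorphism of the exterior algebra. -/
def wedgeParity : ExteriorAlgebra ℂ K →ₗ[ℂ] ExteriorAlgebra ℂ K :=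
  (CliffordAlgebra.involute (Q := (0 : QuadraticForm ℂ K))).toLinearMap

theorem wedgeParity_one : wedgeParity (1 : ExteriorAlgebra ℂ K) = 1 :=
  map_one (CliffordAlgebra.involute (Q := (0 : QuadraticForm ℂ K)))

theorem wedgeParity_wedgeLeft (r : K) (y : ExteriorAlgebra ℂ K) :
    wedgeParity (wedgeLeft r y) = -wedgeLeft r (wedgeParity y) :=
  involute_wedgeLeft r y

theorem contract_wedgeParity (p : K) (x : ExteriorAlgebra ℂ K) :
    contract p (wedgeParity x) = -wedgeParity (contract p x) :=
  contract_involute p x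

theorem wedgeInner_wedgeParity (x y : ExteriorAlgebra ℂ K) :
    wedgeInner (wedgeParity x) (wedgeParity y) = wedgeInner x y :=
  wedgeInner_involute x y

theorem wedgeParity_wedgeParity (x : ExteriorAlgebra ℂ K) : wedgeParity (wedgeParity x) = x :=
  CliffordAlgebra.involute_involute x

theorem wedgeParity_map (A : K →L[ℂ] K) (x : ExteriorAlgebra ℂ K) :
    wedgeParity (ExteriorAlgebra.map (A : K →ₗ[ℂ] K) x)
      = ExteriorAlgebra.map (A : K →ₗ[ℂ] K) (wedgeParity x) := by
  induction x using wedge_induction with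
  | h1 => rw [map_one, wedgeParity_one, map_one]
  | hs c x hx => simp only [map_smul, hx]
  | ha x y hx hy => simp only [map_add, hx, hy]
  | hw p x hx => rw [map_wedgeLeft, wedgeParity_wedgeLeft, wedgeParity_wedgeLeft, hx, map_neg,
      map_wedgeLeft]

theorem mul_ι_eq (x : ExteriorAlgebra ℂ K) (p : K) :
    x * ExteriorAlgebra.ι ℂ p = wedgeLeft p (wedgeParity x) := by
  induction x using wedge_induction with
  | h1 => rw [wedgeParity_one, one_mul]; exact (mul_one _).symm
  | hs c x hx => rw [smul_mul_assoc, hx, map_smul, map_smul]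
  | ha x y hx hy => rw [add_mul, hx, hy, map_add, map_add]
  | hw r x hx =>
    rw [wedgeParity_wedgeLeft, map_neg, wedgeLeft_wedgeLeft, neg_neg, ← hx]
    exact mul_assoc _ _ _

theorem contract_anticomm (p r : K) (x : ExteriorAlgebra ℂ K) :
    contract p (contract r x) = -contract r (contract p x) :=
  CliffordAlgebra.contractLeft_comm _ _ _

/-- The operators `x ↦ x ∧ p ± contract q x` commute with `wedgeLeft r + contract s`. -/
theorem commute_of_inner_eq {p q r s : K} (h : ⟪s, p⟫_ℂ = ⟪q, r⟫_ℂ) (x : ExteriorAlgebra ℂ K) :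
    wedgeLeft p (wedgeParity (wedgeLeft r x + contract s x))
        + wedgeParity (contract q (wedgeLeft r x + contract s x))
      = wedgeLeft r (wedgeLeft p (wedgeParity x) + wedgeParity (contract q x))
        + contract s (wedgeLeft p (wedgeParity x) + wedgeParity (contract q x)) := by
  simp only [map_add, wedgeParity_wedgeLeft, contract_wedgeLeft, contract_wedgeParity, map_neg,
    map_sub, map_smul]
  rw [wedgeLeft_wedgeLeft p r, contract_anticomm q s, h]
  simp only [map_neg]
  abel

/-! ### The antilinear reversal of wedge products. -/

variable (j : K ≃ₛₗᵢ[starRingEnd ℂ] K)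

/-- `p ↦ wedgeLeft (j p)`, with values in the conjugate opposite algebra. -/
def reverseOp : K →ₗ[ℂ] ConjEndOp K where
  toFun p := MulOpposite.op (wedgeLeft (j p))
  map_add' p r := by
    have : wedgeLeft (j (p + r)) = wedgeLeft (j p) + wedgeLeft (j r) := by
      ext x; simp [wedgeLeft, add_mul]
    rw [this]; rfl
  map_smul' c p := by
    have : wedgeLeft (j (c • p)) = conj c • wedgeLeft (j p) := by
      rw [map_smulₛₗ]
      ext x; simp [wedgeLeft]
    rw [this, RingHom.id_apply, Algebra.smul_def]
    exact (Algebra.smul_def (A := (Module.End ℂ (ExteriorAlgebra ℂ K))ᵐᵒᵖ) (conj c)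
      (MulOpposite.op (wedgeLeft (j p))))

theorem reverseOp_mul_self (p : K) : (reverseOp j p * reverseOp j p : ConjEndOp K) = 0 :=
  congrArg MulOpposite.op (LinearMap.ext (wedgeLeft_self (j p)))

/-- `p₁ ∧ ⋯ ∧ pₙ ↦ wedgeLeft (j pₙ) ∘ ⋯ ∘ wedgeLeft (j p₁)`. -/
def reverseAll : ExteriorAlgebra ℂ K →ₐ[ℂ] ConjEndOp K :=
  ExteriorAlgebra.lift ℂ ⟨reverseOp j, reverseOp_mul_self j⟩

/-- The antilinear map `p₁ ∧ ⋯ ∧ pₙ ↦ j pₙ ∧ ⋯ ∧ j p₁`. -/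
def wedgeReverse (x : ExteriorAlgebra ℂ K) : ExteriorAlgebra ℂ K :=
  (reverseAll j x).act 1

theorem wedgeReverse_one : wedgeReverse j 1 = 1 := by
  unfold wedgeReverse
  rw [map_one (reverseAll j), ConjEndOp.act_one]; rfl

theorem wedgeReverse_add (x y : ExteriorAlgebra ℂ K) :
    wedgeReverse j (x + y) = wedgeReverse j x + wedgeReverse j y := by
  unfold wedgeReverse
  rw [map_add, ConjEndOp.act_add, LinearMap.add_apply]

theorem wedgeReverse_smul (c : ℂ) (x : ExteriorAlgebra ℂ K) :
    wedgeReverse j (c • x) = conj c • wedgeReverse j x := by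
  unfold wedgeReverse
  rw [map_smul, ConjEndOp.act_smul, LinearMap.smul_apply]

theorem wedgeReverse_neg (x : ExteriorAlgebra ℂ K) :
    wedgeReverse j (-x) = -wedgeReverse j x := by
  simpa using wedgeReverse_smul j (-1) x

theorem wedgeReverse_sub (x y : ExteriorAlgebra ℂ K) :
    wedgeReverse j (x - y) = wedgeReverse j x - wedgeReverse j y := by
  rw [sub_eq_add_neg, wedgeReverse_add, wedgeReverse_neg, sub_eq_add_neg]

theorem reverseAll_wedgeLeft_act (p : K) (x y : ExteriorAlgebra ℂ K) :
    (reverseAll j (wedgeLeft p x)).act y = (reverseAll j x).act (wedgeLeft (j p) y) := by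
  have h : reverseAll j (wedgeLeft p x) = (reverseOp j p * reverseAll j x : ConjEndOp K) := by
    unfold reverseAll wedgeLeft
    rw [LinearMap.mulLeft_apply, map_mul, ExteriorAlgebra.lift_ι_apply]
  rw [h, ConjEndOp.act_mul]; rfl

theorem reverseAll_act (x y : ExteriorAlgebra ℂ K) :
    (reverseAll j x).act y = wedgeReverse j x * y := by
  induction x using wedge_induction generalizing y with
  | h1 => rw [wedgeReverse_one, map_one, ConjEndOp.act_one, one_mul]; rfl
  | hs c x hx => rw [wedgeReverse_smul, map_smul, ConjEndOp.act_smul, LinearMap.smul_apply, hx,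
      smul_mul_assoc]
  | ha x y hx hy => rw [wedgeReverse_add, map_add, ConjEndOp.act_add, LinearMap.add_apply, hx, hy,
      add_mul]
  | hw p x hx =>
    rw [reverseAll_wedgeLeft_act, hx,
      show wedgeReverse j (wedgeLeft p x) = _ from (reverseAll_wedgeLeft_act j p x 1).trans (hx _)]
    simp [wedgeLeft, mul_assoc]

theorem wedgeReverse_wedgeLeft (p : K) (x : ExteriorAlgebra ℂ K) :
    wedgeReverse j (wedgeLeft p x) = wedgeLeft (j p) (wedgeParity (wedgeReverse j x)) := by
  rw [← mul_ι_eq, wedgeReverse, reverseAll_wedgeLeft_act, reverseAll_act]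
  simp [wedgeLeft]

theorem wedgeReverse_wedgeParity (x : ExteriorAlgebra ℂ K) :
    wedgeReverse j (wedgeParity x) = wedgeParity (wedgeReverse j x) := by
  induction x using wedge_induction with
  | h1 => rw [wedgeParity_one, wedgeReverse_one, wedgeParity_one]
  | hs c x hx => rw [map_smul, wedgeReverse_smul, wedgeReverse_smul, map_smul, hx]
  | ha x y hx hy => rw [map_add, wedgeReverse_add, wedgeReverse_add, map_add, hx, hy]
  | hw p x hx =>
    rw [wedgeParity_wedgeLeft, wedgeReverse_neg, wedgeReverse_wedgeLeft, hx,
      wedgeReverse_wedgeLeft, wedgeParity_wedgeLeft]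

/-- Reversal turns a contraction that starts at the first factor into one that starts at the last;
starting from the other end costs a parity. -/
theorem contract_wedgeReverse (p : K) (x : ExteriorAlgebra ℂ K) :
    contract (j p) (wedgeReverse j x) = wedgeParity (wedgeReverse j (contract p x)) := by
  induction x using wedge_induction with
  | h1 => simp [wedgeReverse_one, contract_one, show wedgeReverse j 0 = 0 by
      simpa using wedgeReverse_smul j 0 0]
  | hs c x hx => rw [map_smul, wedgeReverse_smul, wedgeReverse_smul, map_smul, map_smul, hx]
  | ha x y hx hy => rw [map_add, wedgeReverse_add, wedgeReverse_add, map_add, map_add, hx, hy]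
  | hw r x hx =>
    rw [wedgeReverse_wedgeLeft, contract_wedgeLeft, contract_wedgeParity, hx,
      wedgeParity_wedgeParity, contract_wedgeLeft, wedgeReverse_sub, wedgeReverse_smul,
      wedgeReverse_wedgeLeft, map_sub, wedgeParity_wedgeLeft, wedgeParity_wedgeParity, map_smul,
      inner_conj_symm, map_neg]
    rw [show ⟪j p, j r⟫_ℂ = ⟪r, p⟫_ℂ from inner_map_map_of_antiunitary j.toLinearIsometry p r]

theorem wedgeInner_wedgeReverse (x y : ExteriorAlgebra ℂ K) :
    wedgeInner (wedgeReverse j x) (wedgeReverse j y) = wedgeInner y x := by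
  induction x using wedge_induction generalizing y with
  | h1 =>
    rw [wedgeReverse_one]
    induction y using wedge_induction with
    | h1 => rw [wedgeReverse_one]
    | hs c y hy => rw [wedgeReverse_smul, wedgeInner_smul_left, wedgeInner_smul_right, hy]
    | ha y z hy hz => rw [wedgeReverse_add, wedgeInner_add_left, wedgeInner_add_right, hy, hz]
    | hw p y hy =>
      rw [wedgeReverse_wedgeLeft, ← wedgeInner_contract_left, wedgeInner_wedge_left, contract_one,
        contract_one, wedgeInner_zero_left]
      simp [wedgeInner]
  | hs c x hx => rw [wedgeReverse_smul, wedgeInner_smul_left, wedgeInner_smul_right, hx,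
      Complex.conj_conj]
  | ha x y hx hy => rw [wedgeReverse_add, wedgeInner_add_left, wedgeInner_add_right, hx, hy]
  | hw p x hx =>
    rw [wedgeReverse_wedgeLeft, wedgeInner_wedge_left, contract_wedgeReverse,
      wedgeInner_wedgeParity, hx, wedgeInner_contract_left]

theorem wedgeReverse_map {A B : K →L[ℂ] K} (h : ∀ x, j (A x) = B (j x))
    (x : ExteriorAlgebra ℂ K) :
    wedgeReverse j (ExteriorAlgebra.map (A : K →ₗ[ℂ] K) x)
      = ExteriorAlgebra.map (B : K →ₗ[ℂ] K) (wedgeReverse j x) := by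
  induction x using wedge_induction with
  | h1 => rw [map_one, wedgeReverse_one, map_one]
  | hs c x hx => rw [map_smul, wedgeReverse_smul, wedgeReverse_smul, map_smul, hx]
  | ha x y hx hy => rw [map_add, wedgeReverse_add, wedgeReverse_add, map_add, hx, hy]
  | hw p x hx =>
    rw [map_wedgeLeft, wedgeReverse_wedgeLeft, wedgeReverse_wedgeLeft, hx, h, wedgeParity_map,
      map_wedgeLeft]

variable {j} in
theorem wedgeReverse_wedgeReverse (hj : Function.Involutive j) (x : ExteriorAlgebra ℂ K) :
    wedgeReverse j (wedgeReverse j x) = x := by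
  induction x using wedge_induction with
  | h1 => rw [wedgeReverse_one, wedgeReverse_one]
  | hs c x hx => rw [wedgeReverse_smul, wedgeReverse_smul, hx, Complex.conj_conj]
  | ha x y hx hy => rw [wedgeReverse_add, wedgeReverse_add, hx, hy]
  | hw p x hx =>
    rw [wedgeReverse_wedgeLeft, wedgeReverse_wedgeLeft, wedgeReverse_wedgeParity, hx,
      wedgeParity_wedgeParity, hj]

variable {j} in
theorem wedgeReverse_contract_wedgeReverse (hj : Function.Involutive j) (p : K)
    (x : ExteriorAlgebra ℂ K) :
    wedgeReverse j (contract p (wedgeReverse j x)) = wedgeParity (contract (j p) x) := by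
  have h := contract_wedgeReverse j p (wedgeReverse j x)
  rw [wedgeReverse_wedgeReverse hj] at h
  rw [h, wedgeParity_wedgeParity]

/-- `p₁ ∧ ⋯ ∧ pₙ ↦ j pₙ ∧ ⋯ ∧ j p₁`, on the space with scalar product. -/
def PreFock.reverse : PreFock K →ₛₗᵢ[starRingEnd ℂ] PreFock K where
  toFun := wedgeReverse j
  map_add' := wedgeReverse_add j
  map_smul' := wedgeReverse_smul j
  norm_map' x := by
    rw [norm_eq_sqrt_re_inner (𝕜 := ℂ), norm_eq_sqrt_re_inner (𝕜 := ℂ) x,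
      PreFock.inner_def, PreFock.inner_def]
    exact congrArg _ (congrArg _ (wedgeInner_wedgeReverse j x x))

/-- The antilinear operator `p₁ ∧ ⋯ ∧ pₙ ↦ j pₙ ∧ ⋯ ∧ j p₁` on the Fock space. -/
def fockReverseCLM : Fock K →SL[starRingEnd ℂ] Fock K :=
  ContinuousLinearMap.completion (PreFock.reverse j).toContinuousLinearMap

theorem fockReverseCLM_coe (x : PreFock K) :
    fockReverseCLM j (x : Fock K) = (PreFock.reverse j x : Fock K) :=
  ContinuousLinearMap.completion_apply_coe _ _

variable {j}

theorem fockReverseCLM_fockReverseCLM (hj : Function.Involutive j) (x : Fock K) :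
    fockReverseCLM j (fockReverseCLM j x) = x := by
  induction x using UniformSpace.Completion.induction_on with
  | hp => exact isClosed_eq (by fun_prop) (by fun_prop)
  | ih x =>
    rw [fockReverseCLM_coe, fockReverseCLM_coe]
    exact congrArg _ (wedgeReverse_wedgeReverse hj x)

/-- The antiunitary involution `p₁ ∧ ⋯ ∧ pₙ ↦ j pₙ ∧ ⋯ ∧ j p₁` of the Fock space. -/
def fockReverse (hj : Function.Involutive j) : Fock K ≃ₛₗᵢ[starRingEnd ℂ] Fock K where
  toFun := fockReverseCLM j
  map_add' := map_add _
  map_smul' c x := (fockReverseCLM j).map_smulₛₗ c x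
  invFun := fockReverseCLM j
  left_inv := fockReverseCLM_fockReverseCLM hj
  right_inv := fockReverseCLM_fockReverseCLM hj
  norm_map' x := by
    change ‖fockReverseCLM j x‖ = ‖x‖
    induction x using UniformSpace.Completion.induction_on with
    | hp => exact isClosed_eq (by fun_prop) (by fun_prop)
    | ih x =>
      rw [fockReverseCLM_coe, UniformSpace.Completion.norm_coe, UniformSpace.Completion.norm_coe,
        LinearIsometry.norm_map]

theorem fockReverse_coe (hj : Function.Involutive j) (x : PreFock K) :
    fockReverse hj (x : Fock K) = (PreFock.reverse j x : Fock K) :=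
  fockReverseCLM_coe j x

theorem fockReverse_fockReverse (hj : Function.Involutive j) (x : Fock K) :
    fockReverse hj (fockReverse hj x) = x :=
  fockReverseCLM_fockReverseCLM hj x

end Reversal

/-! ### The Fock space as a completion of the exterior algebra -/

section OfWedge

variable {K : Type*} [NormedAddCommGroup K] [InnerProductSpace ℂ K]

/-- The dense embedding of the exterior algebra into the Fock space. -/
def ofWedge : ExteriorAlgebra ℂ K →ₗ[ℂ] Fock K :=
  (UniformSpace.Completion.toComplₗᵢ (𝕜 := ℂ) (E := PreFock K)).toLinearMap

theorem denseRange_ofWedge : DenseRange (ofWedge : ExteriorAlgebra ℂ K → Fock K) :=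
  UniformSpace.Completion.denseRange_coe (α := PreFock K)

theorem ofWedge_one : ofWedge (1 : ExteriorAlgebra ℂ K) = vacuum K := rfl

theorem inner_ofWedge (x y : ExteriorAlgebra ℂ K) :
    ⟪ofWedge x, ofWedge y⟫_ℂ = wedgeInner x y :=
  UniformSpace.Completion.inner_coe (𝕜 := ℂ) (E := PreFock K) x y

theorem ofWedge_induction {p : Fock K → Prop} (ψ : Fock K) (hp : IsClosed {ψ | p ψ})
    (h : ∀ x, p (ofWedge x)) : p ψ :=
  UniformSpace.Completion.induction_on (α := PreFock K) ψ hp h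

theorem creation_ofWedge (p : K) (x : ExteriorAlgebra ℂ K) :
    creation p (ofWedge x) = ofWedge (wedgeLeft p x) :=
  ContinuousLinearMap.completion_apply_coe _ _

theorem annihilation_ofWedge (p : K) (x : ExteriorAlgebra ℂ K) :
    annihilation p (ofWedge x) = ofWedge (contract p x) :=
  ContinuousLinearMap.completion_apply_coe _ _

theorem parity_ofWedge (x : ExteriorAlgebra ℂ K) :
    parity (ofWedge x) = ofWedge (wedgeParity x) :=
  ContinuousLinearMap.completion_apply_coe _ _

theorem fockReverse_ofWedge {j : K ≃ₛₗᵢ[starRingEnd ℂ] K} (hj : Function.Involutive j)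
    (x : ExteriorAlgebra ℂ K) :
    fockReverse hj (ofWedge x) = ofWedge (wedgeReverse j x) :=
  fockReverse_coe hj x

theorem inner_fockReverse {j : K ≃ₛₗᵢ[starRingEnd ℂ] K} (hj : Function.Involutive j)
    (φ ψ : Fock K) : ⟪fockReverse hj φ, ψ⟫_ℂ = ⟪fockReverse hj ψ, φ⟫_ℂ := by
  have := inner_map_map_of_antiunitary (fockReverse hj).toLinearIsometry φ (fockReverse hj ψ)
  simpa [fockReverse_fockReverse] using this

theorem star_creation (p : K) : star (creation p) = annihilation p := by
  rw [ContinuousLinearMap.star_eq_adjoint, eq_comm, ContinuousLinearMap.eq_adjoint_iff]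
  intro φ ψ
  induction φ using ofWedge_induction with
  | hp => exact isClosed_eq (by fun_prop) (by fun_prop)
  | h x =>
    induction ψ using ofWedge_induction with
    | hp => exact isClosed_eq (by fun_prop) (by fun_prop)
    | h y =>
      rw [creation_ofWedge, annihilation_ofWedge, inner_ofWedge, inner_ofWedge,
        wedgeInner_contract_left]

theorem star_parity : star (parity : Fock K →L[ℂ] Fock K) = parity := by
  rw [ContinuousLinearMap.star_eq_adjoint, eq_comm, ContinuousLinearMap.eq_adjoint_iff]
  intro φ ψ
  induction φ using ofWedge_induction with
  | hp => exact isClosed_eq (by fun_prop) (by fun_prop)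
  | h x =>
    induction ψ using ofWedge_induction with
    | hp => exact isClosed_eq (by fun_prop) (by fun_prop)
    | h y =>
      rw [parity_ofWedge, parity_ofWedge, inner_ofWedge, inner_ofWedge, ← wedgeInner_wedgeParity,
        wedgeParity_wedgeParity]

variable [CompleteSpace K]

theorem fockMap_ofWedge (A : K →L[ℂ] K) (hA : ‖A‖ ≤ 1) (x : ExteriorAlgebra ℂ K) :
    fockMap A hA (ofWedge x) = ofWedge (ExteriorAlgebra.map (A : K →ₗ[ℂ] K) x) :=
  fockMap_coe A hA x

omit [CompleteSpace K] in
theorem continuous_ofWedge_wedgeLeft (x : ExteriorAlgebra ℂ K) :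
    Continuous fun p : K => ofWedge (wedgeLeft p x) := by
  let f : K →ₗ[ℂ] Fock K :=
    { toFun := fun p => ofWedge (wedgeLeft p x)
      map_add' := fun p q => by simp [wedgeLeft, add_mul]
      map_smul' := fun c p => by simp [wedgeLeft] }
  refine (f.mkContinuous ‖(show PreFock K from x)‖ fun p => ?_).continuous
  rw [mul_comm]
  exact (UniformSpace.Completion.norm_coe (E := PreFock K) _).trans_le (PreFock.norm_wedge_le p x)

/-- The closure of the range contains the vacuum and is stable under creation of vectors `A p`.
Wedge products depend continuously on each factor and the vectors `A p` are dense, so every wedge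
product lies in this closure. -/
theorem denseRange_fockMap {A : K →L[ℂ] K} (hA : ‖A‖ ≤ 1) (hd : DenseRange A) :
    DenseRange (fockMap A hA) := by
  have hcr (p : K) (ψ : Fock K) :
      creation (A p) (fockMap A hA ψ) = fockMap A hA (creation p ψ) := by
    induction ψ using ofWedge_induction with
    | hp => exact isClosed_eq (by fun_prop) (by fun_prop)
    | h x => rw [fockMap_ofWedge, creation_ofWedge, creation_ofWedge, fockMap_ofWedge,
        map_wedgeLeft]
  let W := (LinearMap.range (fockMap A hA : Fock K →ₗ[ℂ] Fock K)).topologicalClosure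
  have hWc : IsClosed (W : Set (Fock K)) := Submodule.isClosed_topologicalClosure _
  have hW (p : K) : ∀ ψ ∈ W, creation (A p) ψ ∈ W := by
    intro ψ hψ
    refine (isClosed_closure.preimage (creation (A p)).continuous).closure_subset_iff.2 ?_ hψ
    rintro _ ⟨φ, rfl⟩
    exact subset_closure ⟨creation p φ, (hcr p φ).symm⟩
  intro ψ
  change ψ ∈ W
  induction ψ using ofWedge_induction with
  | hp => exact hWc
  | h x =>
    induction x using wedge_induction with
    | h1 =>
      refine subset_closure ⟨ofWedge 1, ?_⟩
      exact (fockMap_ofWedge A hA 1).trans (congrArg _ (map_one _))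
    | hs c x hx => rw [map_smul]; exact W.smul_mem c hx
    | ha x y hx hy => rw [map_add]; exact W.add_mem hx hy
    | hw p x hx =>
      have hcl := hWc.preimage (continuous_ofWedge_wedgeLeft x)
      refine hcl.closure_subset_iff.2 ?_ (hd p)
      rintro _ ⟨r, rfl⟩
      have := hW r _ hx
      rwa [creation_ofWedge] at this

theorem injective_of_denseRange {E : Type*} [NormedAddCommGroup E] [InnerProductSpace ℂ E]
    [CompleteSpace E] {b : E →L[ℂ] E} (hb : IsSelfAdjoint b) (hd : DenseRange b) :
    Function.Injective b := by
  rw [injective_iff_map_eq_zero]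
  intro x hx
  refine hd.eq_zero_of_inner_left ℂ fun y => ?_
  rw [← inner_apply_of_isSelfAdjoint hb, hx, inner_zero_left]

end OfWedge

/-! ### The modular theory of the field algebra of a standard pair -/

/-- The data of a modular conjugation `j` and of commuting contractions `b`, `c` such that the
modular operator is `c b⁻¹`, with `d` a square root of `b c`. -/
structure ModularPair (K : Type*) [NormedAddCommGroup K] [InnerProductSpace ℂ K]
    [CompleteSpace K] where
  j : K ≃ₛₗᵢ[starRingEnd ℂ] K
  b : K →L[ℂ] K
  c : K →L[ℂ] K
  d : K →L[ℂ] K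
  involutive : Function.Involutive j
  selfAdjoint_b : IsSelfAdjoint b
  selfAdjoint_c : IsSelfAdjoint c
  selfAdjoint_d : IsSelfAdjoint d
  sq_add_sq : b * b + c * c = 1
  d_sq : d * d = b * c
  commute : Commute b c
  norm_b_le : ‖b‖ ≤ 1
  norm_c_le : ‖c‖ ≤ 1
  norm_d_le : ‖d‖ ≤ 1
  intertwine : ∀ x, j (b x) = c (j x)
  injective : Function.Injective b

namespace ModularPair

variable {K : Type*} [NormedAddCommGroup K] [InnerProductSpace ℂ K] [CompleteSpace K]
  (m : ModularPair K)

theorem intertwine' (x : K) : m.j (m.c x) = m.b (m.j x) := by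
  have := m.intertwine (m.j x)
  rw [m.involutive] at this
  rw [← this, m.involutive]

theorem apply_comm (x : K) : m.b (m.c x) = m.c (m.b x) :=
  congrArg (fun T : K →L[ℂ] K => T x) m.commute.eq

theorem sq_add_sq_apply (x : K) : m.b (m.b x) + m.c (m.c x) = x :=
  congrArg (fun T : K →L[ℂ] K => T x) m.sq_add_sq

theorem inner_j (x y : K) : ⟪m.j x, m.j y⟫_ℂ = ⟪y, x⟫_ℂ :=
  inner_map_map_of_antiunitary m.j.toLinearIsometry x y

theorem re_inner_nonneg_of_sq {E : Type*} [NormedAddCommGroup E] [InnerProductSpace ℂ E]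
    [CompleteSpace E] {b c d : E →L[ℂ] E} (hb : IsSelfAdjoint b) (hd : IsSelfAdjoint d)
    (h : d * d = b * c) (w : E) : 0 ≤ (⟪b w, c w⟫_ℂ).re := by
  rw [inner_apply_of_isSelfAdjoint hb, show b (c w) = d (d w) from
    congrArg (fun T : E →L[ℂ] E => T w) h.symm, ← inner_apply_of_isSelfAdjoint hd]
  exact inner_self_nonneg (𝕜 := ℂ)

theorem isQuotientPair : IsQuotientPair m.b m.c where
  selfAdjoint_left := m.selfAdjoint_b
  selfAdjoint_right := m.selfAdjoint_c
  commute := m.commute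
  injective := m.injective
  nonneg := re_inner_nonneg_of_sq m.selfAdjoint_b m.selfAdjoint_d m.d_sq

/-- The second quantization of `b`. -/
abbrev fb : Fock K →L[ℂ] Fock K := fockMap m.b m.norm_b_le

/-- The second quantization of `c`. -/
abbrev fc : Fock K →L[ℂ] Fock K := fockMap m.c m.norm_c_le

/-- The second quantized modular conjugation. -/
abbrev fj : Fock K ≃ₛₗᵢ[starRingEnd ℂ] Fock K := fockReverse m.involutive

theorem denseRange_fb : DenseRange m.fb :=
  denseRange_fockMap _ (denseRange_of_injective m.selfAdjoint_b m.injective)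

theorem norm_bc_le : ‖m.b * m.c‖ ≤ 1 :=
  (norm_mul_le _ _).trans (mul_le_one₀ m.norm_b_le (norm_nonneg _) m.norm_c_le)

/-- Positivity of the product does not need a functional calculus on the Fock space: second
quantization is multiplicative, so `b c = d²` becomes `F(b) F(c) = F(d)²` with `F(d)` self-adjoint.
Injectivity of `F(b)` comes from its dense range. -/
theorem isQuotientPair_fock : IsQuotientPair m.fb m.fc where
  selfAdjoint_left := fockMap_isSelfAdjoint _ m.selfAdjoint_b
  selfAdjoint_right := fockMap_isSelfAdjoint _ m.selfAdjoint_c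
  commute := (fockMap_mul _ _ m.norm_bc_le rfl).trans
    (fockMap_mul _ _ m.norm_bc_le m.commute.eq.symm).symm
  injective := injective_of_denseRange (fockMap_isSelfAdjoint _ m.selfAdjoint_b) m.denseRange_fb
  nonneg := re_inner_nonneg_of_sq (d := fockMap m.d m.norm_d_le)
    (fockMap_isSelfAdjoint _ m.selfAdjoint_b) (fockMap_isSelfAdjoint _ m.selfAdjoint_d)
    ((fockMap_mul _ _ m.norm_bc_le m.d_sq).trans (fockMap_mul _ _ m.norm_bc_le rfl).symm)

theorem fj_fb (ψ : Fock K) : m.fj (m.fb ψ) = m.fc (m.fj ψ) := by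
  induction ψ using ofWedge_induction with
  | hp =>
    have := m.fj.continuous
    exact isClosed_eq (by fun_prop) (by fun_prop)
  | h x =>
    rw [fockMap_ofWedge, fockReverse_ofWedge, fockReverse_ofWedge, fockMap_ofWedge,
      wedgeReverse_map m.j m.intertwine]

/-- The operator `c(b j u)* + c(b u)`. -/
def generator (u : K) : Fock K →L[ℂ] Fock K :=
  creation (m.b (m.j u)) + annihilation (m.b u)

theorem generator_ofWedge (u : K) (x : ExteriorAlgebra ℂ K) :
    m.generator u (ofWedge x)
      = ofWedge (wedgeLeft (m.b (m.j u)) x + contract (m.b u) x) := by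
  rw [generator, add_apply, creation_ofWedge, annihilation_ofWedge, map_add]

theorem star_generator (u : K) : star (m.generator u) = m.generator (m.j u) := by
  rw [generator, generator, star_add, star_creation, ← star_creation (m.b u), star_star,
    m.involutive, add_comm]

/-- The transform of `generator u` under the second quantization of `b`. -/
def lowered (u : K) : Module.End ℂ (ExteriorAlgebra ℂ K) :=
  wedgeLeft (m.j u) + contract (m.b (m.b u))

theorem lowered_apply (u : K) (x : ExteriorAlgebra ℂ K) :
    m.lowered u x = wedgeLeft (m.j u) x + contract (m.b (m.b u)) x := rfl

theorem generator_fb (u : K) (x : ExteriorAlgebra ℂ K) :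
    m.generator u (m.fb (ofWedge x)) = m.fb (ofWedge (m.lowered u x)) := by
  rw [fockMap_ofWedge, generator_ofWedge, fockMap_ofWedge, lowered_apply,
    map_add (ExteriorAlgebra.map _), map_wedgeLeft, contract_map, m.selfAdjoint_b.star_eq]

theorem reverse_lowered_reverse (u : K) (x : ExteriorAlgebra ℂ K) :
    wedgeReverse m.j (m.lowered u (wedgeReverse m.j x)) = wedgeLeft u (wedgeParity x) +
      wedgeParity (contract (m.j (m.b (m.b u))) x) := by
  rw [lowered_apply, wedgeReverse_add, wedgeReverse_wedgeLeft, m.involutive,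
    wedgeReverse_wedgeReverse m.involutive, wedgeReverse_contract_wedgeReverse m.involutive]

/-- This is the commutation of an algebra with its modular conjugate, transported to the exterior
algebra. The contraction terms cancel because `⟪b² v, u⟫ = ⟪v, b² u⟫` and `j` is antiunitary. -/
theorem lowered_comm (u v : K) (x : ExteriorAlgebra ℂ K) :
    wedgeReverse m.j (m.lowered u (wedgeReverse m.j (m.lowered v x)))
      = m.lowered v (wedgeReverse m.j (m.lowered u (wedgeReverse m.j x))) := by
  rw [reverse_lowered_reverse, reverse_lowered_reverse, lowered_apply, lowered_apply]
  refine commute_of_inner_eq ?_ x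
  rw [inner_j, inner_apply_of_isSelfAdjoint m.selfAdjoint_b,
    inner_apply_of_isSelfAdjoint m.selfAdjoint_b]

theorem fj_generator_fj_ofWedge (u : K) (x : ExteriorAlgebra ℂ K) :
    m.fj (m.generator u (m.fj (ofWedge x))) = ofWedge (wedgeLeft (m.c u) (wedgeParity x) +
      wedgeParity (contract (m.c (m.j u)) x)) := by
  rw [fockReverse_ofWedge, generator_ofWedge, fockReverse_ofWedge, wedgeReverse_add,
    wedgeReverse_wedgeLeft, wedgeReverse_wedgeReverse m.involutive,
    wedgeReverse_contract_wedgeReverse m.involutive, m.intertwine, m.intertwine, m.involutive]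

/-- The same cancellation on the Fock space, now through `⟪b v, c u⟫ = ⟪c v, b u⟫`; it places the
conjugated generators in the commutant. -/
theorem fj_generator_fj_comm (u v : K) (ψ : Fock K) :
    m.fj (m.generator u (m.fj (m.generator v ψ)))
      = m.generator v (m.fj (m.generator u (m.fj ψ))) := by
  induction ψ using ofWedge_induction with
  | hp =>
    have := m.fj.continuous
    exact isClosed_eq (by fun_prop) (by fun_prop)
  | h x =>
    rw [fj_generator_fj_ofWedge, generator_ofWedge, fj_generator_fj_ofWedge, generator_ofWedge]
    refine congrArg _ (commute_of_inner_eq ?_ x)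
    rw [← m.intertwine, ← m.intertwine', inner_j, inner_apply_of_isSelfAdjoint m.selfAdjoint_b,
      inner_apply_of_isSelfAdjoint m.selfAdjoint_c, apply_comm]

end ModularPair

/-! ### The Tomita operator of the field algebra. -/

namespace ModularPair

variable {K : Type*} [NormedAddCommGroup K] [InnerProductSpace ℂ K] [CompleteSpace K]
  (m : ModularPair K)

/-- The span of the products of the operators `lowered u`, applied to `1`. -/
inductive Reachable : ExteriorAlgebra ℂ K → Prop
  | one : Reachable 1
  | smul (c : ℂ) (x) : Reachable x → Reachable (c • x)
  | add (x y) : Reachable x → Reachable y → Reachable (x + y)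
  | lowered (u x) : Reachable x → Reachable (m.lowered u x)

variable {m} in
theorem Reachable.sub {x y : ExteriorAlgebra ℂ K} (hx : m.Reachable x) (hy : m.Reachable y) :
    m.Reachable (x - y) := by
  rw [sub_eq_add_neg, ← neg_one_smul ℂ y]
  exact .add _ _ hx (.smul _ _ hy)

variable {m} in
-- A contraction anticommutes with `lowered u` up to a scalar and kills `1`. Creation, being
-- `lowered` minus a contraction, therefore also preserves reachability, whence `reachable`.
theorem Reachable.contract {x : ExteriorAlgebra ℂ K} (hx : m.Reachable x) (p : K) :
    m.Reachable (contract p x) := by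
  induction hx with
  | one =>
    rw [contract_one, ← zero_smul ℂ (1 : ExteriorAlgebra ℂ K)]
    exact .smul _ _ .one
  | smul c x _ h => rw [map_smul]; exact .smul _ _ h
  | add x y _ _ hx hy => rw [map_add]; exact .add _ _ hx hy
  | lowered u x hx h =>
    have : CAR.contract p (m.lowered u x)
        = ⟪p, m.j u⟫_ℂ • x - m.lowered u (CAR.contract p x) := by
      rw [lowered_apply, lowered_apply, map_add, contract_wedgeLeft, contract_anticomm p]
      abel
    rw [this]
    exact .sub (.smul _ _ hx) (.lowered _ _ h)

theorem reachable (x : ExteriorAlgebra ℂ K) : m.Reachable x := by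
  induction x using wedge_induction with
  | h1 => exact .one
  | hs c x hx => exact .smul _ _ hx
  | ha x y hx hy => exact .add _ _ hx hy
  | hw p x hx =>
    have : wedgeLeft p x
        = m.lowered (m.j p) x - CAR.contract (m.b (m.b (m.j p))) x := by
      rw [lowered_apply, m.involutive, add_sub_cancel_right]
    rw [this]
    exact .sub (.lowered _ _ hx) (hx.contract _)

/-- The von Neumann algebra of the operators `generator u`. -/
def algebra : Set (Fock K →L[ℂ] Fock K) :=
  Set.centralizer (Set.centralizer (Set.range m.generator))

/-- `x` belongs to the algebra of the operators `generator u`, acts on the range of the second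
quantization of `b` like `T`, and its adjoint acts there like `T'`. -/
structure IsLift (x : Fock K →L[ℂ] Fock K) (T T' : Module.End ℂ (ExteriorAlgebra ℂ K)) :
    Prop where
  apply : ∀ y, x (m.fb (ofWedge y)) = m.fb (ofWedge (T y))
  star_apply : ∀ y, star x (m.fb (ofWedge y)) = m.fb (ofWedge (T' y))
  comm : ∀ u y, T' (wedgeReverse m.j (m.lowered u (wedgeReverse m.j y)))
    = wedgeReverse m.j (m.lowered u (wedgeReverse m.j (T' y)))
  one : T' 1 = wedgeReverse m.j (T 1)
  mem : x ∈ Subalgebra.centralizer ℂ (Set.centralizer (Set.range m.generator))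
  conj_comm : ∀ v ψ, m.fj (x (m.fj (m.generator v ψ))) = m.generator v (m.fj (x (m.fj ψ)))

theorem lowered_one (u : K) : m.lowered u 1 = wedgeLeft (m.j u) 1 := by
  rw [lowered_apply, contract_one, add_zero]

/-- `x` is a polynomial in the generators, `T` the same polynomial in the lowered operators, and
`T'` its formal adjoint. Multiplication by a generator on the left of `x` puts a lowered operator on
the right of `T'`. On the vector `1` it equals its reversed conjugate, which commutes with `T'` and
can be moved outside; this propagates the key identity `T' 1 = wedgeReverse m.j (T 1)`. -/
theorem exists_isLift (y : ExteriorAlgebra ℂ K) : ∃ x T T', m.IsLift x T T' ∧ T 1 = y := by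
  induction m.reachable y with
  | one =>
    exact ⟨1, 1, 1, ⟨fun _ => rfl, fun _ => by rw [star_one]; rfl, fun _ _ => rfl,
      (wedgeReverse_one m.j).symm, one_mem _, fun v ψ => by
        simp [fockReverse_fockReverse]⟩, rfl⟩
  | smul c _ _ h =>
    obtain ⟨x, T, T', h, rfl⟩ := h
    refine ⟨c • x, c • T, conj c • T', ⟨fun y => ?_, fun y => ?_, fun u y => ?_, ?_,
      Subalgebra.smul_mem _ h.mem c, fun v ψ => ?_⟩, rfl⟩
    · simp [h.apply]
    · simp [star_smul, h.star_apply]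
    · simp only [LinearMap.smul_apply, h.comm, wedgeReverse_smul, map_smul, Complex.conj_conj]
    · simp only [LinearMap.smul_apply, h.one, wedgeReverse_smul]
    · simp [h.conj_comm, map_smulₛₗ]
  | add _ _ _ _ h₁ h₂ =>
    obtain ⟨x₁, T₁, T₁', h₁, rfl⟩ := h₁
    obtain ⟨x₂, T₂, T₂', h₂, rfl⟩ := h₂
    refine ⟨x₁ + x₂, T₁ + T₂, T₁' + T₂', ⟨fun y => ?_, fun y => ?_, fun u y => ?_, ?_,
      Subalgebra.add_mem _ h₁.mem h₂.mem, fun v ψ => ?_⟩, rfl⟩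
    · simp [h₁.apply, h₂.apply]
    · simp [star_add, h₁.star_apply, h₂.star_apply]
    · simp only [LinearMap.add_apply, h₁.comm, h₂.comm, wedgeReverse_add, map_add]
    · simp only [LinearMap.add_apply, h₁.one, h₂.one, wedgeReverse_add]
    · simp [h₁.conj_comm, h₂.conj_comm]
  | lowered u _ _ h =>
    obtain ⟨x, T, T', h, rfl⟩ := h
    refine ⟨m.generator u * x, m.lowered u * T, T' * m.lowered (m.j u), ⟨fun y => ?_, fun y => ?_,
      fun v y => ?_, ?_, Subalgebra.mul_mem _ ?_ h.mem, fun v ψ => ?_⟩, rfl⟩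
    · change m.generator u (x _) = _
      rw [h.apply, generator_fb]; rfl
    · rw [star_mul, star_generator]
      change star x (m.generator _ _) = _
      rw [generator_fb, h.star_apply]; rfl
    · change T' (m.lowered _ _) = _
      rw [← lowered_comm, h.comm]; rfl
    · change T' (m.lowered _ 1) = wedgeReverse m.j (m.lowered u (T 1))
      have h₁ : m.lowered (m.j u) 1
          = wedgeReverse m.j (m.lowered u (wedgeReverse m.j 1)) := by
        rw [wedgeReverse_one, lowered_one, lowered_one, wedgeReverse_wedgeLeft, wedgeReverse_one,
          wedgeParity_one]
      rw [h₁, h.comm, h.one, wedgeReverse_wedgeReverse m.involutive]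
    · exact Set.subset_centralizer_centralizer ⟨u, rfl⟩
    · change m.fj (m.generator u (x _)) = m.generator v (m.fj (m.generator u (x _)))
      rw [← fockReverse_fockReverse m.involutive (x _), h.conj_comm, fj_generator_fj_comm,
        fockReverse_fockReverse]

theorem fb_vacuum : m.fb (vacuum K) = vacuum K := by
  rw [← ofWedge_one, fockMap_ofWedge, map_one]

theorem fj_vacuum : m.fj (vacuum K) = vacuum K := by
  rw [← ofWedge_one, fockReverse_ofWedge, wedgeReverse_one]

theorem fj_fc (ψ : Fock K) : m.fj (m.fc ψ) = m.fb (m.fj ψ) := by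
  have := m.fj_fb (m.fj ψ)
  rw [fockReverse_fockReverse] at this
  rw [← this, fockReverse_fockReverse]

/-- The last clause holds because the conjugate of `x` commutes with the generators, hence lies in
their commutant and commutes with the whole bicommutant. -/
theorem exists_mem_algebra (y : ExteriorAlgebra ℂ K) :
    ∃ x ∈ m.algebra, x (vacuum K) = m.fb (ofWedge y) ∧
      star x (vacuum K) = m.fj (m.fc (ofWedge y)) ∧
      (∀ A ∈ m.algebra, ∀ ψ, A (m.fj (x (m.fj ψ))) = m.fj (x (m.fj (A ψ)))) := by
  obtain ⟨x, T, T', h, rfl⟩ := m.exists_isLift y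
  refine ⟨x, h.mem, ?_, ?_, fun A hA ψ => ?_⟩
  · rw [← h.apply, ofWedge_one, fb_vacuum]
  · have := h.star_apply 1
    rw [ofWedge_one, fb_vacuum] at this
    rw [this, h.one, fj_fc, fockReverse_ofWedge]
  · let n : Fock K →L[ℂ] Fock K :=
      (fockReverseCLM m.j).comp (x.comp (fockReverseCLM m.j))
    have hn : n ∈ Set.centralizer (Set.range m.generator) := by
      rintro _ ⟨v, rfl⟩
      ext ψ
      exact (h.conj_comm v ψ).symm
    exact (congrArg (fun T : Fock K →L[ℂ] Fock K => T ψ) (hA n hn)).symm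

theorem dense_image_fb : Dense (Set.range fun y => m.fb (ofWedge y)) :=
  m.denseRange_fb.comp denseRange_ofWedge m.fb.continuous

theorem isCyclic : IsCyclic m.algebra (vacuum K) := by
  refine m.dense_image_fb.mono ?_
  rintro _ ⟨y, rfl⟩
  obtain ⟨x, hx, h, -⟩ := m.exists_mem_algebra y
  exact ⟨x, hx, h⟩

/-- The vacuum is cyclic for the operators `J x J`, which commute with the algebra, so `A Ω = 0`
gives `A J x J Ω = J x J A Ω = 0` on a dense set. -/
theorem isSeparating : IsSeparating m.algebra (vacuum K) := by
  intro A hA h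
  have hd : Dense (Set.range fun y => m.fj (m.fb (ofWedge y))) :=
    m.fj.surjective.denseRange.comp m.dense_image_fb m.fj.continuous
  have hd' : DenseRange fun y => m.fj (m.fb (ofWedge y)) := hd
  refine ContinuousLinearMap.coeFn_injective
    (hd'.equalizer A.continuous (0 : _ →L[ℂ] _).continuous ?_)
  ext1 y
  obtain ⟨x, -, hx, -, hc⟩ := m.exists_mem_algebra y
  have := hc A hA (vacuum K)
  rw [h, map_zero, map_zero, map_zero, fj_vacuum, hx] at this
  exact this

/-- One inclusion is the core `(F(b) y, J F(c) y)` obtained from `exists_mem_algebra`. For the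
other, `F(b) J A* Ω = F(c) A Ω` is tested against `y`: with `x Ω = F(b) y`, the commutation of `A`
with `J x J` moves the adjoint from `A` to `x`. -/
theorem tomita_eq : tomita m.algebra (vacuum K) =
    {z | ∃ x : (quotientOp m.fb m.fc).domain,
      z = ((x : Fock K), m.fj (quotientOp m.fb m.fc x))} := by
  have hq := m.isQuotientPair_fock.closure_eq m.fj denseRange_ofWedge
  refine Set.Subset.antisymm (closure_minimal ?_ (hq ▸ isClosed_closure)) ?_
  · rintro _ ⟨A, hA, rfl⟩
    have hmem : (A (vacuum K), m.fj (star A (vacuum K))) ∈ (quotientOp m.fb m.fc).graph := by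
      rw [m.isQuotientPair_fock.mem_graph]
      refine denseRange_ofWedge.eq_of_inner_left ℂ fun y => ?_
      obtain ⟨x, -, hx, hx', hc⟩ := m.exists_mem_algebra y
      rw [inner_apply_of_isSelfAdjoint m.isQuotientPair_fock.selfAdjoint_left,
        inner_apply_of_isSelfAdjoint m.isQuotientPair_fock.selfAdjoint_right,
        inner_fockReverse, ContinuousLinearMap.star_eq_adjoint,
        ContinuousLinearMap.adjoint_inner_right, ← hx]
      have h₁ := hc A hA (vacuum K)
      rw [fj_vacuum] at h₁
      rw [h₁, inner_fockReverse, fj_vacuum, ← ContinuousLinearMap.adjoint_inner_left,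
        ← ContinuousLinearMap.star_eq_adjoint, hx', inner_fockReverse, fockReverse_fockReverse]
    obtain ⟨z, hz, hz'⟩ := (LinearPMap.mem_graph_iff _).1 hmem
    refine ⟨z, Prod.ext hz.symm ?_⟩
    change _ = m.fj (quotientOp m.fb m.fc z)
    rw [hz', fockReverse_fockReverse]
  · rw [← hq]
    refine closure_mono ?_
    rintro _ ⟨_, ⟨y, rfl⟩, rfl⟩
    obtain ⟨x, hxm, hx, hx', -⟩ := m.exists_mem_algebra y
    exact ⟨x, hxm, Prod.ext hx.symm hx'.symm⟩

theorem isModularConjugation : IsModularConjugation m.algebra (vacuum K) m.fj :=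
  ⟨_, m.isQuotientPair_fock.isPositiveSqrt m.fj m.tomita_eq, m.tomita_eq⟩

theorem denseRange_fc : DenseRange m.fc := by
  refine denseRange_fockMap _ (denseRange_of_injective m.selfAdjoint_c ?_)
  rw [injective_iff_map_eq_zero]
  intro x hx
  have h := m.intertwine' x
  rw [hx, map_zero] at h
  exact (map_eq_zero_iff _ m.j.injective).1 ((map_eq_zero_iff _ m.injective).1 h.symm)

/-- The positive factor is unique, and two antiunitary factors agree on its range, which contains
the dense range of `F(c)`. -/
theorem eq_of_isModularConjugation {J : Fock K ≃ₛₗᵢ[starRingEnd ℂ] Fock K}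
    (hJ : IsModularConjugation m.algebra (vacuum K) J) : J = m.fj := by
  obtain ⟨D, hD, h⟩ := hJ
  obtain rfl := hD.unique (m.isQuotientPair_fock.isPositiveSqrt m.fj m.tomita_eq)
  have heq (w : Fock K) : J (m.fc w) = m.fj (m.fc w) := by
    have hw : (m.fb w, m.fc w) ∈ (quotientOp m.fb m.fc).graph :=
      m.isQuotientPair_fock.mem_graph.2 (m.isQuotientPair_fock.apply_comm w)
    obtain ⟨z, hz, hz'⟩ := (LinearPMap.mem_graph_iff _).1 hw
    simp only at hz hz'
    have hmem : ((z : Fock K), J (quotientOp m.fb m.fc z)) ∈ tomita m.algebra (vacuum K) := by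
      rw [h]; exact ⟨z, rfl⟩
    rw [tomita_eq] at hmem
    obtain ⟨z', hz₁⟩ := hmem
    obtain ⟨h₁, h₂⟩ := Prod.mk.inj hz₁
    obtain rfl := Subtype.ext h₁
    rwa [hz'] at h₂
  exact LinearIsometryEquiv.ext fun ψ => congrFun
    (m.denseRange_fc.equalizer J.continuous m.fj.continuous (funext heq)) ψ

end ModularPair

/-! ### The twist -/

section Twist

variable {K : Type*} [NormedAddCommGroup K] [InnerProductSpace ℂ K]

theorem twist_ofWedge (x : ExteriorAlgebra ℂ K) :
    twist (ofWedge x) = ofWedge ((1 + Complex.I)⁻¹ • (x + Complex.I • wedgeParity x)) := by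
  rw [map_smul, map_add, map_smul, ← parity_ofWedge]
  rfl

theorem star_twist_ofWedge (x : ExteriorAlgebra ℂ K) :
    star twist (ofWedge x) = ofWedge ((1 - Complex.I)⁻¹ • (x - Complex.I • wedgeParity x)) := by
  have h : star (twist : Fock K →L[ℂ] Fock K)
      = (1 - Complex.I)⁻¹ • (1 - Complex.I • parity) := by
    simp [twist, star_smul, star_add, star_parity, sub_eq_add_neg]
  rw [h, map_smul, map_sub, map_smul, ← parity_ofWedge]
  rfl

/-- For an operator `A` that anticommutes with the parity, `Z̃ A Z̃* = ½ A (1 - i Z)² = -i A Z`. The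
factors `i` on `p` and `q` cancel this `-i`, the annihilation part being antilinear in its argument.
-/
theorem twist_field_twist_ofWedge (p q : K) (x : ExteriorAlgebra ℂ K) :
    twist ((creation (Complex.I • p) + annihilation (Complex.I • q)) (star twist (ofWedge x)))
      = ofWedge (wedgeLeft p (wedgeParity x) + wedgeParity (contract q x)) := by
  have hI : (1 + Complex.I)⁻¹ * (1 - Complex.I)⁻¹ = 2⁻¹ := by
    rw [← mul_inv]
    congr 1
    linear_combination -Complex.I_sq
  have hw (y : ExteriorAlgebra ℂ K) : wedgeLeft (Complex.I • p) y = Complex.I • wedgeLeft p y := by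
    simp [wedgeLeft]
  rw [star_twist_ofWedge, add_apply, creation_ofWedge, annihilation_ofWedge, ← map_add,
    twist_ofWedge]
  congr 1
  rw [hw, contract_smul, Complex.conj_I]
  simp only [map_smul, map_sub, map_add, LinearMap.smul_apply, contract_wedgeParity,
    wedgeParity_wedgeLeft, wedgeParity_wedgeParity, map_neg, smul_add, smul_sub, smul_smul,
    smul_neg, neg_smul]
  generalize (1 + Complex.I)⁻¹ = u at hI ⊢
  generalize (1 - Complex.I)⁻¹ = v at hI ⊢
  match_scalars
  · linear_combination u * v * Complex.I * Complex.I_sq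
  · linear_combination (-2 * u * v) * Complex.I_sq + 2 * hI
  · linear_combination (-u * v * Complex.I) * Complex.I_sq
  · linear_combination (-2 * u * v) * Complex.I_sq + 2 * hI

end Twist

/-! ### The one-particle modular data -/

section Polar

variable {K : Type*} [NormedAddCommGroup K] [InnerProductSpace ℂ K] [CompleteSpace K]

/-- `j A j⁻¹` is positive with square `B²`, so it equals `B` by uniqueness of the positive square
root. -/
theorem intertwine_of_sq_intertwine (j : K ≃ₛₗᵢ[starRingEnd ℂ] K) {A B : K →L[ℂ] K} (hA : 0 ≤ A)
    (hB : 0 ≤ B) (h : ∀ x, j (A (A x)) = B (B (j x))) (x : K) : j (A x) = B (j x) := by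
  let C : K →L[ℂ] K := (j : K →SL[starRingEnd ℂ] K).comp
    (A.comp (j.symm : K →SL[starRingEnd ℂ] K))
  have hCx (x : K) : C x = j (A (j.symm x)) := rfl
  have hj (x y : K) : ⟪j x, y⟫_ℂ = ⟪j.symm y, x⟫_ℂ := by
    have := inner_map_map_of_antiunitary j.toLinearIsometry x (j.symm y)
    simpa using this
  have hC : 0 ≤ C := by
    rw [ContinuousLinearMap.nonneg_iff_isPositive, ContinuousLinearMap.isPositive_def] at hA ⊢
    refine ⟨fun x y => ?_, fun x => ?_⟩
    · change ⟪j (A (j.symm x)), y⟫_ℂ = ⟪x, j (A (j.symm y))⟫_ℂ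
      rw [hj, ← inner_conj_symm x, hj, inner_conj_symm]
      exact (hA.1 _ _).symm
    · change 0 ≤ (⟪j (A (j.symm x)), x⟫_ℂ).re
      rw [hj, ← inner_conj_symm, Complex.conj_re]
      exact hA.2 _
  have hCC : C * C = B * B := by
    ext y
    change j (A (j.symm (j (A (j.symm y))))) = B (B y)
    rw [j.symm_apply_apply, h, j.apply_symm_apply]
  have hCB : C = B := by
    rw [← CFC.sqrt_unique hCC hC, CFC.sqrt_mul_self B hB]
  rw [← hCB, hCx, j.symm_apply_apply]

/-- The modular data from `B = b²` and the antilinear self-adjoint operator `X = j b c`. -/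
theorem exists_modularPair {B : K →L[ℂ] K} (hB : 0 ≤ B) (hB' : 0 ≤ 1 - B)
    (hBi : Function.Injective B) (hBi' : Function.Injective (1 - B : K →L[ℂ] K))
    (X : K →SL[starRingEnd ℂ] K) (hX : ∀ v w, ⟪v, X w⟫_ℂ = ⟪w, X v⟫_ℂ)
    (hXX : ∀ w, X (X w) = B w - B (B w)) (hXB : ∀ w, X (B w) = X w - B (X w)) :
    ∃ m : ModularPair K, m.b * m.b = B ∧ ∀ w, m.j (m.b (m.c w)) = X w := by
  set b := CFC.sqrt B with hb
  set c := CFC.sqrt (1 - B) with hc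
  have hbb : b * b = B := CFC.sqrt_mul_sqrt_self B hB
  have hcc : c * c = 1 - B := CFC.sqrt_mul_sqrt_self (1 - B) hB'
  have hb0 : 0 ≤ b := CFC.sqrt_nonneg B
  have hc0 : 0 ≤ c := CFC.sqrt_nonneg (1 - B)
  have hbs : IsSelfAdjoint b := hb0.isSelfAdjoint
  have hcs : IsSelfAdjoint c := hc0.isSelfAdjoint
  have hbc : Commute b c :=
    (((Commute.one_right B).sub_right (Commute.refl B)).cfcₙ_nnreal _ |>.symm.cfcₙ_nnreal _).symm
  -- A square root of `b c`, carried along to prove positivity after second quantization.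
  set d := CFC.sqrt b * CFC.sqrt c with hd
  have hd' : Commute (CFC.sqrt b) (CFC.sqrt c) := ((hbc.cfcₙ_nnreal _).symm.cfcₙ_nnreal _).symm
  have hds : IsSelfAdjoint d := by
    rw [hd, IsSelfAdjoint, star_mul, (CFC.sqrt_nonneg b).isSelfAdjoint.star_eq,
      (CFC.sqrt_nonneg c).isSelfAdjoint.star_eq, hd'.eq]
  have hdd : d * d = b * c := by
    rw [hd, hd'.symm.mul_mul_mul_comm, CFC.sqrt_mul_sqrt_self b hb0, CFC.sqrt_mul_sqrt_self c hc0]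
  have hsum : b * b + c * c = 1 := by rw [hbb, hcc, add_sub_cancel]
  have hnorm (x : K) : ‖b x‖ ^ 2 + ‖c x‖ ^ 2 = ‖x‖ ^ 2 := by
    have h := congrArg (fun T : K →L[ℂ] K => (⟪x, T x⟫_ℂ).re) hsum
    have h' : (⟪x, b (b x) + c (c x)⟫_ℂ).re = (⟪x, x⟫_ℂ).re := h
    rw [inner_add_right, ← inner_apply_of_isSelfAdjoint hbs, ← inner_apply_of_isSelfAdjoint hcs,
      Complex.add_re] at h'
    simp only [← inner_self_eq_norm_sq (𝕜 := ℂ)]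
    exact h'
  have hbn (x : K) : ‖b x‖ ≤ ‖x‖ := by
    refine abs_le_of_sq_le_sq' ?_ (norm_nonneg _) |>.2
    nlinarith [hnorm x, sq_nonneg ‖c x‖]
  have hcn (x : K) : ‖c x‖ ≤ ‖x‖ := by
    refine abs_le_of_sq_le_sq' ?_ (norm_nonneg _) |>.2
    nlinarith [hnorm x, sq_nonneg ‖b x‖]
  have hdn (x : K) : ‖d x‖ ≤ ‖x‖ := by
    refine abs_le_of_sq_le_sq' ?_ (norm_nonneg _) |>.2
    have h : ⟪d x, d x⟫_ℂ = ⟪b x, c x⟫_ℂ := by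
      rw [inner_apply_of_isSelfAdjoint hds, inner_apply_of_isSelfAdjoint hbs]
      exact congrArg (fun T : K →L[ℂ] K => ⟪x, T x⟫_ℂ) hdd
    rw [← inner_self_eq_norm_sq (𝕜 := ℂ), h]
    refine (RCLike.re_le_norm _).trans ((norm_inner_le_norm _ _).trans ?_)
    rw [sq]
    exact mul_le_mul (hbn x) (hcn x) (norm_nonneg _) (norm_nonneg _)
  have hbi : Function.Injective b := fun x y h =>
    hBi (by rw [← hbb]; exact congrArg b h)
  have hci : Function.Injective c := fun x y h =>
    hBi' (by rw [← hcc]; exact congrArg c h)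
  have hTs : IsSelfAdjoint (b * c) := by
    rw [← hdd, IsSelfAdjoint, star_mul, hds.star_eq]
  have hT0 : 0 ≤ b * c := by
    have := star_mul_self_nonneg d
    rwa [hds.star_eq, hdd] at this
  have hTd : DenseRange (b * c) := denseRange_of_injective hTs (hbi.comp hci)
  have hTT (w : K) : (b * c) ((b * c) w) = X (X w) := by
    have h : b * c * (b * c) = B - B * B := by
      rw [hbc.symm.mul_mul_mul_comm, hbb, hcc, mul_sub, mul_one]
    rw [hXX]
    exact congrArg (fun T : K →L[ℂ] K => T w) h
  have hXn (w : K) : ‖X w‖ = ‖(b * c) w‖ := by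
    have h : ⟪X w, X w⟫_ℂ = ⟪(b * c) w, (b * c) w⟫_ℂ := by
      rw [hX, ← hTT, inner_apply_of_isSelfAdjoint hTs]
    rw [← sq_eq_sq₀ (norm_nonneg _) (norm_nonneg _), ← inner_self_eq_norm_sq (𝕜 := ℂ), h,
      inner_self_eq_norm_sq]
  -- Since `X² = (b c)²` and `X` is symmetric, `‖X w‖ = ‖b c w‖`; so `b c w ↦ X w` extends from the
  -- dense range of `b c` to an isometry.
  let j₀ : K →SL[starRingEnd ℂ] K :=
    (X : K →ₛₗ[starRingEnd ℂ] K).extendOfNorm ((b * c : K →L[ℂ] K) : K →ₗ[ℂ] K)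
  have hj₀ (w : K) : j₀ ((b * c) w) = X w :=
    LinearMap.extendOfNorm_eq hTd ⟨1, fun w => ((hXn w).trans (one_mul _).symm).le⟩ w
  have hjn (x : K) : ‖j₀ x‖ = ‖x‖ := by
    induction x using hTd.induction_on with
    | hp => exact isClosed_eq (by fun_prop) (by fun_prop)
    | ih w => rw [hj₀, hXn]
  let ji : K →ₛₗᵢ[starRingEnd ℂ] K := ⟨j₀.toLinearMap, hjn⟩
  have hXd : Dense (Set.range X) := by
    have h : (LinearMap.range (X : K →ₛₗ[starRingEnd ℂ] K)).topologicalClosure = ⊤ := by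
      rw [Submodule.topologicalClosure_eq_top_iff, Submodule.eq_bot_iff]
      intro v hv
      have hv' : X v = 0 := by
        refine ext_inner_left ℂ fun w => ?_
        rw [← hX, inner_zero_right, ← inner_conj_symm,
          (Submodule.mem_orthogonal _ _).1 hv (X w) ⟨w, rfl⟩, map_zero]
      have h₁ := hTT v
      rw [hv', map_zero] at h₁
      have hTi : Function.Injective (b * c) := hbi.comp hci
      exact (map_eq_zero_iff _ hTi).1 ((map_eq_zero_iff _ hTi).1 h₁)
    exact Submodule.dense_iff_topologicalClosure_eq_top.2 h
  have hsurj : Function.Surjective ji := by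
    rw [← Set.range_eq_univ, ← ji.isometry.isClosedEmbedding.isClosed_range.closure_eq,
      ← dense_iff_closure_eq]
    refine hXd.mono ?_
    rintro _ ⟨w, rfl⟩
    exact ⟨_, hj₀ w⟩
  let j := LinearIsometryEquiv.ofSurjective ji hsurj
  have hj (w : K) : j ((b * c) w) = X w := hj₀ w
  have hjT (x : K) : j ((b * c) x) = (b * c) (j x) := by
    refine intertwine_of_sq_intertwine j hT0 hT0 (fun x => ?_) x
    induction x using hTd.induction_on with
    | hp =>
      have := j.continuous
      exact isClosed_eq (by fun_prop) (by fun_prop)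
    | ih w => rw [hj, hj, hTT, hTT]
  -- By uniqueness of square roots only `j b² = c² j` is needed; on the vectors `b c w` this is `X B
  -- = (1 - B) X`.
  have hjb (x : K) : j (b x) = c (j x) := by
    refine intertwine_of_sq_intertwine j hb0 hc0 (fun x => ?_) x
    induction x using hTd.induction_on with
    | hp =>
      have := j.continuous
      exact isClosed_eq (by fun_prop) (by fun_prop)
    | ih w =>
      have h₁ : b (b ((b * c) w)) = (b * c) (B w) := by
        have : b * b * (b * c) = b * c * B := by
          rw [← hbb]
          exact (((Commute.refl b).mul_right hbc).mul_left ((Commute.refl b).mul_right hbc)).eq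
        exact congrArg (fun T : K →L[ℂ] K => T w) this
      have h₂ : c (c (X w)) = X w - B (X w) :=
        congrArg (fun T : K →L[ℂ] K => T (X w)) hcc
      rw [h₁, hj, hj, hXB, h₂]
  have hjj (x : K) : j (j x) = x := by
    induction x using (hTd.comp hTd (b * c : K →L[ℂ] K).continuous).induction_on with
    | hp =>
      have := j.continuous
      exact isClosed_eq (by fun_prop) (by fun_prop)
    | ih w =>
      rw [Function.comp_apply, hjT, hj, hj, hTT]
  exact ⟨⟨j, b, c, d, hjj, hbs, hcs, hds, hsum, hdd, hbc,
    b.opNorm_le_bound zero_le_one (by simpa using hbn),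
    c.opNorm_le_bound zero_le_one (by simpa using hcn),
    d.opNorm_le_bound zero_le_one (by simpa using hdn), hjb, hbi⟩, hbb, hj⟩

end Polar

/-! ### The one-particle modular data of a subspace in generic position -/

section Standard

variable {H : Type*} [NormedAddCommGroup H] [InnerProductSpace ℂ H] [CompleteSpace H]
  {Γ : H ≃ₛₗᵢ[starRingEnd ℂ] H}

namespace BasisProjection

variable (P : BasisProjection Γ)

theorem apply_apply (f : H) : P.toCLM (P.toCLM f) = P.toCLM f :=
  congrArg (fun T : H →L[ℂ] H => T f) P.isStarProjection.isIdempotentElem.eq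

theorem proj_coe (p : P.range) : P.proj (p : H) = p := by
  obtain ⟨_, g, rfl⟩ := p
  exact Subtype.ext (P.apply_apply g)

/-- `P`, as a map onto the one-particle space. -/
def projL : H →L[ℂ] P.range :=
  P.toCLM.codRestrict P.range fun f => ⟨f, rfl⟩

theorem projL_apply (f : H) : P.projL f = P.proj f := rfl

theorem coe_proj (f : H) : (P.proj f : H) = P.toCLM f := rfl

theorem inner_coe (p : P.range) (f : H) : ⟪(p : H), f⟫_ℂ = ⟪p, P.proj f⟫_ℂ := by
  rw [Submodule.coe_inner, coe_proj,
    ← inner_apply_of_isSelfAdjoint P.isStarProjection.isSelfAdjoint, ← coe_proj, proj_coe]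

variable (hΓ : Function.Involutive Γ)

include hΓ in
omit [CompleteSpace H] in
theorem inner_conj (f g : H) : ⟪Γ f, g⟫_ℂ = ⟪Γ g, f⟫_ℂ := by
  have := inner_map_map_of_antiunitary Γ.toLinearIsometry f (Γ g)
  simpa [hΓ g] using this

theorem proj_add_conj (f : H) : (P.proj f : H) + Γ (P.proj (Γ f)) = f := P.add_conj f

theorem proj_conj_coe (p : P.range) : P.proj (Γ (p : H)) = 0 := by
  have h := P.proj_add_conj (p : H)
  rw [proj_coe, add_eq_left, map_eq_zero_iff _ Γ.injective] at h
  exact Subtype.ext h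

theorem proj_add_conj_coe (p r : P.range) : P.proj ((p : H) + Γ (r : H)) = p := by
  rw [← projL_apply, map_add, projL_apply, projL_apply, proj_coe, P.proj_conj_coe, add_zero]

include hΓ in
theorem inner_add_conj (p r s t : P.range) :
    ⟪(p : H) + Γ (r : H), (s : H) + Γ (t : H)⟫_ℂ = ⟪p, s⟫_ℂ + ⟪t, r⟫_ℂ := by
  rw [inner_add_left, inner_coe, P.proj_add_conj_coe, inner_conj hΓ, map_add, hΓ,
    add_comm (Γ (s : H)), ← inner_conj_symm ((t : H) + _), inner_coe, P.proj_add_conj_coe,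
    inner_conj_symm]

include hΓ in
theorem norm_add_conj_sq (p r : P.range) :
    ‖(p : H) + Γ (r : H)‖ ^ 2 = ‖p‖ ^ 2 + ‖r‖ ^ 2 := by
  simp only [← inner_self_eq_norm_sq (𝕜 := ℂ)]
  rw [P.inner_add_conj hΓ, map_add]

end BasisProjection

variable (hΓ : Function.Involutive Γ) (P : BasisProjection Γ) {𝔮 : Submodule ℂ H}

include hΓ in
omit [CompleteSpace H] in
theorem starProjection_conj [𝔮.HasOrthogonalProjection] (hΓ𝔮 : ∀ x ∈ 𝔮, Γ x ∈ 𝔮) (f : H) :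
    𝔮.starProjection (Γ f) = Γ (𝔮.starProjection f) := by
  refine Submodule.eq_starProjection_of_mem_of_inner_eq_zero (u := Γ f)
    (hΓ𝔮 _ (𝔮.starProjection_apply_mem f)) fun w hw => ?_
  rw [← map_sub, BasisProjection.inner_conj hΓ, ← inner_conj_symm,
    Submodule.starProjection_inner_eq_zero _ _ (hΓ𝔮 w hw), map_zero]

theorem ModularPair.norm_sq_add_norm_sq {K : Type*} [NormedAddCommGroup K] [InnerProductSpace ℂ K]
    [CompleteSpace K] (m : ModularPair K) (x : K) : ‖m.b x‖ ^ 2 + ‖m.c x‖ ^ 2 = ‖x‖ ^ 2 := by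
  simp only [← inner_self_eq_norm_sq (𝕜 := ℂ)]
  rw [← map_add, inner_apply_of_isSelfAdjoint m.selfAdjoint_b,
    inner_apply_of_isSelfAdjoint m.selfAdjoint_c, ← inner_add_right, m.sq_add_sq_apply]

/-- The isometry `u ↦ b u + Γ b j u`. -/
def standardIsometry (m : ModularPair P.range) : P.range →ₗᵢ[ℂ] H where
  toFun u := (m.b u : H) + Γ (m.b (m.j u) : H)
  map_add' u v := by
    simp only [map_add, Submodule.coe_add]
    abel
  map_smul' c u := by
    simp only [map_smul, map_smulₛₗ, Submodule.coe_smul, Complex.conj_conj, smul_add,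
      RingHom.id_apply]
  norm_map' u := by
    change ‖(m.b u : H) + Γ (m.b (m.j u) : H)‖ = ‖u‖
    rw [← sq_eq_sq₀ (norm_nonneg _) (norm_nonneg _), P.norm_add_conj_sq hΓ, ← m.intertwine',
      LinearIsometryEquiv.norm_map, m.norm_sq_add_norm_sq]

theorem standardIsometry_apply (m : ModularPair P.range) (u : P.range) :
    standardIsometry hΓ P m u = (m.b u : H) + Γ (m.b (m.j u) : H) := rfl

/-- A modular pair on `P H` belongs to `𝔮` if `𝔮 = {b u + Γ b j u}`. -/
def IsModularPairOf (𝔮 : Submodule ℂ H) (m : ModularPair P.range) : Prop :=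
  ∀ q : H, q ∈ 𝔮 ↔ ∃ u, standardIsometry hΓ P m u = q

include hΓ in
-- The relations between `PQ` and `PΓQ` follow from `ΓPΓ = 1 - P` and `QΓ = ΓQ`. A vector of `𝔭`
-- killed by `B` is orthogonal to `𝔮`, and one killed by `1 - B` lies in `𝔮`, so generic position
-- gives both injectivities. The isometry `U` satisfies `U b w = Q w`, which puts its range inside
-- `𝔮`.
theorem exists_isModularPairOf (h𝔮 : IsClosed (𝔮 : Set H)) (hΓ𝔮 : ∀ x ∈ 𝔮, Γ x ∈ 𝔮)
    (hgen : GenericPosition P.range 𝔮) : ∃ m, IsModularPairOf hΓ P 𝔮 m := by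
  have : CompleteSpace 𝔮 := h𝔮.completeSpace_coe
  let Q : H →L[ℂ] H := 𝔮.starProjection
  have hQs (f g : H) : ⟪Q f, g⟫_ℂ = ⟪f, Q g⟫_ℂ := 𝔮.inner_starProjection_left_eq_right f g
  have hQQ (f : H) : Q (Q f) = Q f :=
    Submodule.starProjection_eq_self_iff.2 (𝔮.starProjection_apply_mem f)
  have hQΓ (f : H) : Q (Γ f) = Γ (Q f) := starProjection_conj hΓ hΓ𝔮 f
  let B : P.range →L[ℂ] P.range := P.projL.comp (Q.comp P.range.subtypeL)
  have hBx (w : P.range) : B w = P.proj (Q w) := rfl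
  let X : P.range →SL[starRingEnd ℂ] P.range :=
    P.projL.comp ((Γ : H →SL[starRingEnd ℂ] H).comp (Q.comp P.range.subtypeL))
  have hXx (w : P.range) : X w = P.proj (Γ (Q w)) := rfl
  have hinB (v w : P.range) : ⟪v, B w⟫_ℂ = ⟪(v : H), Q w⟫_ℂ := by rw [hBx, P.inner_coe]
  have hinB' (w : P.range) : ⟪w, B w⟫_ℂ = ⟪Q w, Q w⟫_ℂ := by rw [hinB, hQs, hQQ]
  have hBs : IsSelfAdjoint B := by
    rw [ContinuousLinearMap.isSelfAdjoint_iff_isSymmetric]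
    intro v w
    change ⟪B v, w⟫_ℂ = ⟪v, B w⟫_ℂ
    rw [← inner_conj_symm, hinB, hinB, inner_conj_symm, hQs]
  have hB : 0 ≤ B := by
    rw [ContinuousLinearMap.nonneg_iff_isPositive, ContinuousLinearMap.isPositive_def']
    refine ⟨hBs, fun w => ?_⟩
    change 0 ≤ (⟪B w, w⟫_ℂ).re
    rw [inner_apply_of_isSelfAdjoint hBs, hinB']
    exact inner_self_nonneg (𝕜 := ℂ)
  have h1B (w : P.range) : ⟪w, (1 - B) w⟫_ℂ = ⟪(w : H) - Q w, (w : H) - Q w⟫_ℂ := by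
    change ⟪w, w - B w⟫_ℂ = _
    rw [inner_sub_right, hinB', inner_sub_sub_self, hQs, hQQ, ← hQs, Submodule.coe_inner]
    ring
  have hB' : 0 ≤ 1 - B := by
    rw [ContinuousLinearMap.nonneg_iff_isPositive, ContinuousLinearMap.isPositive_def']
    refine ⟨(IsSelfAdjoint.one _).sub hBs, fun w => ?_⟩
    change 0 ≤ (⟪(1 - B) w, w⟫_ℂ).re
    rw [inner_apply_of_isSelfAdjoint ((IsSelfAdjoint.one _).sub hBs), h1B]
    exact inner_self_nonneg (𝕜 := ℂ)
  have hBi : Function.Injective B := by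
    rw [injective_iff_map_eq_zero]
    intro w hw
    have h := hinB' w
    rw [hw, inner_zero_right, eq_comm, inner_self_eq_zero] at h
    have hmem : (w : H) ∈ P.range ⊓ 𝔮ᗮ :=
      ⟨w.2, (Submodule.starProjection_apply_eq_zero_iff 𝔮).1 h⟩
    rw [hgen.inf_orthogonal_eq_bot] at hmem
    exact Subtype.ext hmem
  have hBi' : Function.Injective (1 - B : P.range →L[ℂ] P.range) := by
    rw [injective_iff_map_eq_zero]
    intro w hw
    have h := h1B w
    rw [hw, inner_zero_right, eq_comm, inner_self_eq_zero, sub_eq_zero, eq_comm] at h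
    have hmem : (w : H) ∈ P.range ⊓ 𝔮 := ⟨w.2, Submodule.starProjection_eq_self_iff.1 h⟩
    rw [hgen.inf_eq_bot] at hmem
    exact Subtype.ext hmem
  have hX (v w : P.range) : ⟪v, X w⟫_ℂ = ⟪w, X v⟫_ℂ := by
    rw [hXx, hXx, ← P.inner_coe, ← P.inner_coe, ← inner_conj_symm,
      BasisProjection.inner_conj hΓ, inner_conj_symm, ← hQΓ, hQs]
  have hdec (f : H) : Γ (P.proj f : H) = Γ f - P.proj (Γ f) := by
    rw [eq_sub_iff_add_eq, add_comm]
    have := P.proj_add_conj (Γ f)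
    rwa [hΓ] at this
  have hXX (w : P.range) : X (X w) = B w - B (B w) := by
    rw [hXx, hXx, ← hQΓ, hdec, hΓ, map_sub, hQQ, hBx, hBx]
    exact map_sub P.projL _ _
  have hXB (w : P.range) : X (B w) = X w - B (X w) := by
    rw [hXx, hBx, ← hQΓ, hdec, map_sub, hQΓ, hQQ, ← P.projL_apply, map_sub, hBx, hXx]
    rfl
  obtain ⟨m, hmB, hmX⟩ := exists_modularPair hB hB' hBi hBi' X hX hXX hXB
  refine ⟨m, fun q => ?_⟩
  let U := standardIsometry hΓ P m
  have hU (w : P.range) : U (m.b w) = Q w := by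
    have h₁ : m.b (m.j (m.b w)) = X w := by
      rw [m.intertwine, ← hmX, m.intertwine, m.intertwine', m.apply_comm]
    have h₂ : m.b (m.b w) = B w := congrArg (fun T : P.range →L[ℂ] P.range => T w) hmB
    change (m.b (m.b w) : H) + Γ (m.b (m.j (m.b w)) : H) = _
    rw [h₁, h₂]
    exact P.proj_add_conj (Q w)
  have hmem (u : P.range) : U u ∈ 𝔮 := by
    induction u using (denseRange_of_injective m.selfAdjoint_b m.injective).induction_on with
    | hp => exact h𝔮.preimage U.continuous
    | ih w => rw [hU]; exact 𝔮.starProjection_apply_mem _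
  constructor
  · intro hq
    let R := LinearMap.range U.toLinearMap
    have : CompleteSpace R := U.isometry.isClosedEmbedding.isClosed_range.completeSpace_coe
    obtain ⟨u, hu⟩ := R.starProjection_apply_mem q
    refine ⟨u, ?_⟩
    -- `U u` is the projection of `q` onto the range of `U`, which contains `Q p` for `p ∈ 𝔭`. As `q
    -- - U u` lies in `𝔮`, orthogonality to `Q p` is orthogonality to `p`.
    have hd : q - U u ∈ P.rangeᗮ ⊓ 𝔮 := by
      have hdq : q - U u ∈ 𝔮 := sub_mem hq (hmem u)
      refine ⟨fun p hp => ?_, hdq⟩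
      have h₁ := R.starProjection_inner_eq_zero q (U (m.b ⟨p, hp⟩)) ⟨_, rfl⟩
      have h₂ : Q (q - U u) = q - U u := Submodule.starProjection_eq_self_iff.2 hdq
      rw [← hu, hU, ← hQs] at h₁
      have h₃ : ⟪q - U u, p⟫_ℂ = 0 := by rw [← h₂]; exact h₁
      rw [← inner_conj_symm, h₃, map_zero]
    rw [hgen.orthogonal_inf_eq_bot, Submodule.mem_bot, sub_eq_zero] at hd
    exact hd.symm
  · rintro ⟨u, rfl⟩
    exact hmem u

end Standard

/-! ### Twisted duality -/

section Duality

variable {H : Type*} [NormedAddCommGroup H] [InnerProductSpace ℂ H] [CompleteSpace H]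
  {Γ : H ≃ₛₗᵢ[starRingEnd ℂ] H} (hΓ : Function.Involutive Γ) (P : BasisProjection Γ)
  {𝔮 : Submodule ℂ H} (m : ModularPair P.range)

theorem proj_standardIsometry (u : P.range) : P.proj (standardIsometry hΓ P m u) = m.b u :=
  P.proj_add_conj_coe _ _

theorem conj_standardIsometry (u : P.range) :
    Γ (standardIsometry hΓ P m u) = standardIsometry hΓ P m (m.j u) := by
  rw [standardIsometry_apply, standardIsometry_apply, map_add, hΓ, m.involutive, add_comm]

theorem field_standardIsometry (u : P.range) :
    field P (standardIsometry hΓ P m u) = m.generator u := by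
  rw [field, conj_standardIsometry, proj_standardIsometry, proj_standardIsometry]; rfl

variable {m}

theorem localAlgebra_eq (h : IsModularPairOf hΓ P 𝔮 m) : localAlgebra P 𝔮 = m.algebra := by
  have : field P '' (𝔮 : Set H) = Set.range m.generator := by
    ext T
    constructor
    · rintro ⟨q, hq, rfl⟩
      obtain ⟨u, rfl⟩ := (h q).1 hq
      exact ⟨u, (field_standardIsometry hΓ P m u).symm⟩
    · rintro ⟨u, rfl⟩
      exact ⟨_, (h _).2 ⟨u, rfl⟩, field_standardIsometry hΓ P m u⟩
  rw [localAlgebra, this]; rfl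

theorem betaGraph_eq (h : IsModularPairOf hΓ P 𝔮 m) : betaGraph P 𝔮 =
    {z | ∃ x : (quotientOp m.b m.c).domain, z = ((x : P.range), m.j (quotientOp m.b m.c x))} := by
  ext z
  constructor
  · rintro ⟨q, hq, rfl⟩
    obtain ⟨u, rfl⟩ := (h q).1 hq
    rw [conj_standardIsometry, proj_standardIsometry, proj_standardIsometry]
    have hmem : (m.b u, m.c u) ∈ (quotientOp m.b m.c).graph :=
      m.isQuotientPair.mem_graph.2 (m.apply_comm u)
    obtain ⟨x, hx, hx'⟩ := (LinearPMap.mem_graph_iff _).1 hmem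
    refine ⟨x, Prod.ext hx.symm ?_⟩
    change m.b (m.j u) = m.j _
    rw [hx', m.intertwine']
  · rintro ⟨x, rfl⟩
    have hx := m.isQuotientPair.mem_graph.1 (LinearPMap.mem_graph _ x)
    set y := quotientOp m.b m.c x
    -- If `x = b u` and `y = c u`, then `b² + c² = 1` forces `u = b x + c y`; conversely `b y = c x`
    -- makes this choice work.
    have hu : m.b (m.b x + m.c y) = x := by
      rw [map_add, m.apply_comm, hx, m.sq_add_sq_apply]
    have hcu : m.c (m.b x + m.c y) = y := by
      rw [map_add, ← m.apply_comm, ← hx, m.sq_add_sq_apply]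
    refine ⟨_, (h _).2 ⟨m.b x + m.c y, rfl⟩, ?_⟩
    rw [conj_standardIsometry, proj_standardIsometry, proj_standardIsometry, ← m.intertwine', hu,
      hcu]

include hΓ in
theorem isPositiveSqrt_oneParticleModular (h : IsModularPairOf hΓ P 𝔮 m) :
    IsPositiveSqrt (quotientOp m.b m.c) (oneParticleModular P 𝔮) :=
  m.isQuotientPair.isPositiveSqrt m.j (betaGraph_eq hΓ P h)

/-! ### The isometry onto the orthogonal complement and the twisted fields. -/

/-- The antilinear map `u ↦ i (c j u - Γ c u)`. -/
def complementMap (m : ModularPair P.range) : P.range →ₛₗᵢ[starRingEnd ℂ] H where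
  toFun u := Complex.I • ((m.c (m.j u) : H) - Γ (m.c u : H))
  map_add' u v := by
    simp only [map_add, Submodule.coe_add, ← smul_add]
    congr 1
    abel
  map_smul' a u := by
    simp only [map_smul, map_smulₛₗ, Submodule.coe_smul, ← smul_sub]
    exact smul_comm _ _ _
  norm_map' u := by
    change ‖Complex.I • ((m.c (m.j u) : H) - Γ (m.c u : H))‖ = ‖u‖
    have h := P.norm_add_conj_sq hΓ (m.c (m.j u)) (-m.c u)
    rw [Submodule.coe_neg, map_neg, ← sub_eq_add_neg, norm_neg, ← m.intertwine,
      LinearIsometryEquiv.norm_map, m.norm_sq_add_norm_sq] at h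
    rw [norm_smul, Complex.norm_I, one_mul, ← m.intertwine]
    exact (sq_eq_sq₀ (norm_nonneg _) (norm_nonneg _)).1 h

theorem complementMap_apply (u : P.range) : complementMap hΓ P m u =
    Complex.I • ((m.c (m.j u) : H) - Γ (m.c u : H)) := rfl

theorem complementMap_eq (u : P.range) : complementMap hΓ P m u =
    ((Complex.I • m.c (m.j u) : P.range) : H) + Γ ((Complex.I • m.c u : P.range) : H) := by
  rw [complementMap_apply, Submodule.coe_smul, Submodule.coe_smul, map_smulₛₗ, Complex.conj_I,
    neg_smul, smul_sub, sub_eq_add_neg]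

theorem field_complementMap (u : P.range) : field P (complementMap hΓ P m u) =
    creation (Complex.I • m.c u) + annihilation (Complex.I • m.c (m.j u)) := by
  have h : Γ (complementMap hΓ P m u) = ((Complex.I • m.c u : P.range) : H) +
      Γ ((Complex.I • m.c (m.j u) : P.range) : H) := by
    rw [complementMap_eq, map_add, hΓ, add_comm]
  rw [field, h, P.proj_add_conj_coe, complementMap_eq, P.proj_add_conj_coe]

theorem fj_field_fj (u : P.range) (ψ : Fock P.range) :
    m.fj (m.generator u (m.fj ψ))
      = twist (field P (complementMap hΓ P m u) (star twist ψ)) := by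
  induction ψ using ofWedge_induction with
  | hp =>
    have := m.fj.continuous
    exact isClosed_eq (by fun_prop) (by fun_prop)
  | h x => rw [m.fj_generator_fj_ofWedge, field_complementMap, twist_field_twist_ofWedge]

theorem mem_orthogonal_iff (h : IsModularPairOf hΓ P 𝔮 m) (f : H) :
    f ∈ 𝔮ᗮ ↔ ∃ u, complementMap hΓ P m u = f := by
  have hinner (p r : P.range) (v : P.range) :
      ⟪standardIsometry hΓ P m v, (p : H) + Γ (r : H)⟫_ℂ = ⟪v, m.b p + m.c (m.j r)⟫_ℂ := by
    have h₁ := m.inner_j (m.j v) (m.b r)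
    rw [m.involutive, inner_apply_of_isSelfAdjoint m.selfAdjoint_b] at h₁
    rw [standardIsometry_apply, P.inner_add_conj hΓ, inner_add_right, ← m.intertwine,
      inner_apply_of_isSelfAdjoint m.selfAdjoint_b, h₁]
  constructor
  · intro hf
    set p := P.proj f
    set r := P.proj (Γ f)
    have hfpr : (p : H) + Γ (r : H) = f := P.proj_add_conj f
    have h₁ : m.b p + m.c (m.j r) = 0 := by
      refine ext_inner_left ℂ fun v => ?_
      rw [← hinner, hfpr, inner_zero_right]
      exact hf _ ((h _).2 ⟨v, rfl⟩)
    have h₂ : m.c (m.j p) = -m.b r := by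
      have := congrArg m.j h₁
      rw [map_add, m.intertwine, m.intertwine', m.involutive, map_zero] at this
      exact eq_neg_of_add_eq_zero_left this
    have hcu : m.c (m.b (m.j p) - m.c r) = -r := by
      rw [map_sub, ← m.apply_comm, h₂, map_neg, ← neg_add', m.sq_add_sq_apply]
    have hbu : m.b (m.b (m.j p) - m.c r) = m.j p := by
      rw [map_sub, m.apply_comm, ← neg_eq_iff_eq_neg.2 h₂, map_neg, sub_neg_eq_add,
        m.sq_add_sq_apply]
    -- The equations `i c j u = p` and `i c u = r` mean `b u = i j p` and `c u = -i r`, and `u = b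
    -- (b u) + c (c u)`.
    refine ⟨Complex.I • (m.b (m.j p) - m.c r), ?_⟩
    rw [complementMap_eq, ← m.intertwine, m.b.map_smul, m.c.map_smul, hcu, hbu, map_smulₛₗ,
      m.involutive, smul_smul, smul_smul, Complex.conj_I, mul_neg, Complex.I_mul_I, neg_neg, one_smul,
      neg_one_smul, neg_neg, hfpr]
  · rintro ⟨u, rfl⟩ q hq
    obtain ⟨v, rfl⟩ := (h q).1 hq
    rw [complementMap_eq, hinner, map_smulₛₗ, map_smulₛₗ, map_smulₛₗ, Complex.conj_I,
      m.intertwine', m.apply_comm, RingHom.id_apply, RingHom.id_apply, neg_smul, add_neg_cancel,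
      inner_zero_right]

/-- The antilinear isometry `b u + Γ b j u ↦ i (c j u - Γ c u)` of `𝔮` onto `𝔮ᗮ`. -/
theorem exists_complementEquiv (h : IsModularPairOf hΓ P 𝔮 m) :
    ∃ V : 𝔮 ≃ₛₗᵢ[starRingEnd ℂ] 𝔮ᗮ, ∀ (x : 𝔮) (u : P.range), standardIsometry hΓ P m u = x →
      (V x : H) = complementMap hΓ P m u := by
  let U' : P.range →ₗᵢ[ℂ] 𝔮 :=
    { toLinearMap := (standardIsometry hΓ P m).toLinearMap.codRestrict 𝔮 fun u => (h _).2 ⟨u, rfl⟩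
      norm_map' := fun u => (standardIsometry hΓ P m).norm_map u }
  let W' : P.range →ₛₗᵢ[starRingEnd ℂ] 𝔮ᗮ :=
    { toLinearMap := (complementMap hΓ P m).toLinearMap.codRestrict 𝔮ᗮ
        fun u => (mem_orthogonal_iff hΓ P h _).2 ⟨u, rfl⟩
      norm_map' := fun u => (complementMap hΓ P m).norm_map u }
  let U := LinearIsometryEquiv.ofSurjective U' fun x => by
    obtain ⟨u, hu⟩ := (h x).1 x.2
    exact ⟨u, Subtype.ext hu⟩
  let W := LinearIsometryEquiv.ofSurjective W' fun x => by
    obtain ⟨u, hu⟩ := (mem_orthogonal_iff hΓ P h x).1 x.2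
    exact ⟨u, Subtype.ext hu⟩
  refine ⟨U.symm.trans W, fun x u hu => ?_⟩
  obtain rfl : U u = x := Subtype.ext hu
  change (W (U.symm (U u)) : H) = _
  rw [U.symm_apply_apply]
  rfl

end Duality

end CAR

end

/-! ### Assembly of the modular data. -/

theorem mainTheorem4 {H : Type*} [NormedAddCommGroup H] [InnerProductSpace ℂ H] [CompleteSpace H]
    (Γ : H ≃ₛₗᵢ[starRingEnd ℂ] H) (hΓ : Function.Involutive Γ) (P : CAR.BasisProjection Γ)
    (𝔮 : Submodule ℂ H) (h𝔮 : IsClosed (𝔮 : Set H)) (hΓ𝔮 : ∀ x ∈ 𝔮, Γ x ∈ 𝔮)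
    (hgen : CAR.GenericPosition P.range 𝔮) :
    CAR.IsCyclic (CAR.localAlgebra P 𝔮) (CAR.vacuum P.range) ∧
    CAR.IsSeparating (CAR.localAlgebra P 𝔮) (CAR.vacuum P.range) ∧
    (∃! J, CAR.IsModularConjugation (CAR.localAlgebra P 𝔮) (CAR.vacuum P.range) J) ∧
    (∃! D, CAR.IsPositiveSqrt D (CAR.oneParticleModular P 𝔮)) ∧
    ∀ J, CAR.IsModularConjugation (CAR.localAlgebra P 𝔮) (CAR.vacuum P.range) J →
    ∀ D, CAR.IsPositiveSqrt D (CAR.oneParticleModular P 𝔮) →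
      ∃ V : 𝔮 ≃ₛₗᵢ[starRingEnd ℂ] 𝔮ᗮ,
        (∀ x : 𝔮, ∃ (h₁ : P.proj (Γ x) ∈ D.domain) (h₂ : P.proj x ∈ D.domain),
          (V x : H) = Complex.I • ((D ⟨_, h₁⟩ : H) - Γ (D ⟨_, h₂⟩ : H))) ∧
        ∀ (x : 𝔮) (ψ : CAR.Fock P.range),
          J (CAR.field P x (J ψ)) =
            CAR.twist (CAR.field P (V x : H) (star CAR.twist ψ)) := by
  obtain ⟨m, hm⟩ := CAR.exists_isModularPairOf hΓ P h𝔮 hΓ𝔮 hgen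
  have hsqrt := CAR.isPositiveSqrt_oneParticleModular hΓ P hm
  rw [CAR.localAlgebra_eq hΓ P hm]
  refine ⟨m.isCyclic, m.isSeparating, ⟨m.fj, m.isModularConjugation,
    fun J hJ => m.eq_of_isModularConjugation hJ⟩, ⟨_, hsqrt, fun D hD => hD.unique hsqrt⟩,
    fun J hJ D hD => ?_⟩
  obtain rfl := m.eq_of_isModularConjugation hJ
  obtain rfl := hD.unique hsqrt
  obtain ⟨V, hV⟩ := CAR.exists_complementEquiv hΓ P hm
  -- Since `P q = b u` and `P Γ q = b j u` for `q = b u + Γ b j u`, the values of `Δ_𝔭^{1/2}` needed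
  -- for `V q` are `c u` and `c j u`.
  have hgraph (u : P.range) : ∃ hu : m.b u ∈ (CAR.quotientOp m.b m.c).domain,
      CAR.quotientOp m.b m.c ⟨m.b u, hu⟩ = m.c u := by
    obtain ⟨⟨x, hx⟩, hxu, h⟩ := (LinearPMap.mem_graph_iff _).1
      (m.isQuotientPair.mem_graph.2 (m.apply_comm u) : (m.b u, m.c u) ∈ _)
    obtain rfl : x = m.b u := hxu
    exact ⟨hx, h⟩
  refine ⟨V, fun x => ?_, fun x ψ => ?_⟩
  · obtain ⟨u, hu⟩ := (hm x).1 x.2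
    obtain ⟨h₁, h₁'⟩ := hgraph (m.j u)
    obtain ⟨h₂, h₂'⟩ := hgraph u
    rw [hV x u hu, ← hu]
    simp only [CAR.conj_standardIsometry, CAR.proj_standardIsometry]
    refine ⟨h₁, h₂, ?_⟩
    rw [h₁', h₂', CAR.complementMap_apply]
  · obtain ⟨u, hu⟩ := (hm x).1 x.2
    rw [hV x u hu, ← hu, CAR.field_standardIsometry, CAR.fj_field_fj]
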